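/- Let $\nu$ be a nonatomic, $\sigma$-finite measure on $[0,1]$ with $\nu([0,1])=\infty$ and $\int_0^1 w\,\nu(dw)<\infty$. Let $(w_i)_{i\in\mathbb N}$ enumerate a Poisson point process on $[0,1]$ with rate measure $\nu$. Given $(w_i)_i$, let $\Pi_{ij}$, $i\le j$, be independent Poisson processes on $[0,\infty)$, with constant rate $w_iw_j$ if $i<j$ and rate $0$ if $i=j$, and put $\Pi_{ji}=\Pi_{ij}$ and $\Pi_i=\bigcup_j\Pi_{ij}$. For $t\ge 0$ let $$D'_{t,i}=|\Pi_i\cap[0,t]|,\qquad \bar D'_{t,i}=\sum_j \mathbf 1\big(|\Pi_{ij}\cap[0,t]|>0\big),$$ $$|V'_t|=\sum_i\mathbf 1(D'_{t,i}>0),\qquad |E'_t|=\tfrac12\sum_i D'_{t,i},\qquad |\bar E'_t|=\tfrac12\sum_i\bar D'_{t,i}$$ be the Poissonized numbers of vertices, of edges of the multigraph, and of edges of the binary graph. Suppose that the tail of $\nu$ is regularly varying, that is, $\alpha\in(0,1)$ and $\ell:\mathbb R_+\to\mathbb R_+$ satisfy $$\nu([x,1])\sim x^{-\alpha}\ell(x^{-1})\quad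 (x\to0^+),\qquad \lim_{x\to\infty}\frac{\ell(cx)}{\ell(x)}=1\ \text{ for all } c>0.$$ Then the expectations $\mathbb E|V'_n|$, $\mathbb E|E'_n|$, $\mathbb E|\bar E'_n|$ are finite for every natural number $n$, and, as $n\to\infty$, $$\mathbb E|V'_n|=\Theta(n^\alpha\ell(n)),\qquad \mathbb E|E'_n|=\Theta(n),\qquad \mathbb E|\bar E'_n|=O\Big(\ell(\sqrt n)\min\big(n^{\frac{1+\alpha}2},\,\ell(n)\,n^{\frac{3\alpha}2}\big)\Big).$$ -/

import Mathlib

open MeasureTheory ProbabilityTheory Filter Asymptotics Topology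
open scoped ENNReal NNReal

noncomputable section

/-- The random sequence `x 0, x 1, …` of points of `S` is an enumeration of a Poisson point process
with rate measure `ν`: the number of points in a measurable set `A` with `ν A < ∞` is Poisson
distributed with parameter `ν A`, and the numbers of points in finitely many pairwise disjoint
measurable sets are independent. -/
structure IsPoissonPointProcess {S Ω : Type*} [MeasurableSpace S] [MeasurableSpace Ω]
    (ν : Measure S) (P : Measure Ω) (x : ℕ → Ω → S) : Prop where
  measurable : ∀ i, Measurable (x i)
  poisson : ∀ A : Set S, MeasurableSet A → ν A ≠ ∞ →
    HasLaw (fun ω => {i | x i ω ∈ A}.encard)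
      ((poissonMeasure (ν A).toNNReal).map (Nat.cast : ℕ → ℕ∞)) P
  indep : ∀ (m : ℕ) (A : Fin m → Set S), (∀ a, MeasurableSet (A a)) →
    (∀ a b, a ≠ b → Disjoint (A a) (A b)) →
    iIndepFun (fun (a : Fin m) (ω : Ω) => {i | x i ω ∈ A a}.encard) P

/-- The rate of the process of edges between the vertices `i` and `j`, when the weights of the
vertices are `u 0, u 1, …` (there are no self-loops). -/
def edgeRate (u : ℕ → unitInterval) (i j : ℕ) : ℝ≥0 :=
  if i = j then 0 else unitInterval.toNNReal (u i) * unitInterval.toNNReal (u j)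

/-- The σ-algebra generated by the sequence of weights. -/
abbrev weightSigma {Ω : Type*} (w : ℕ → Ω → unitInterval) : MeasurableSpace Ω :=
  MeasurableSpace.comap (fun ω i => w i ω) MeasurableSpace.pi

/-- The Poissonized random graph. The vertices are the natural numbers; the vertex weights `w i`
form a Poisson point process on `[0, 1]` with rate measure `ν`. The random set
`T i j ω ⊆ [0, ∞)` is the set of times at which an edge is added between `i` and `j`. Conditionally
on the weights, the `T i j` with `i ≤ j` are independent Poisson processes on `[0, ∞)`, the process
`T i j` having the constant rate `edgeRate`, and `T j i = T i j`.

The field `conditional_law` gives the conditional joint distribution of the numbers of points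
of these processes in finitely many Borel sets of finite length, the sets that belong to the same
process being disjoint: they are independent, and Poisson with parameter rate times length. -/
structure IsPoissonizedGraph {Ω : Type*} [MeasurableSpace Ω] (ν : Measure unitInterval)
    (P : Measure Ω) (w : ℕ → Ω → unitInterval) (T : ℕ → ℕ → Ω → Set ℝ) : Prop where
  weights : IsPoissonPointProcess ν P w
  nonneg : ∀ i j ω, T i j ω ⊆ Set.Ici 0
  symm : ∀ i j ω, T j i ω = T i j ω
  measurable : ∀ i j (B : Set ℝ), MeasurableSet B → Measurable fun ω => (T i j ω ∩ B).encard
  conditional_law : ∀ (m : ℕ) (e : Fin m → ℕ × ℕ) (B : Fin m → Set ℝ) (k : Fin m → ℕ),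
    (∀ a, (e a).1 ≤ (e a).2) →
    (∀ a, MeasurableSet (B a) ∧ B a ⊆ Set.Ici 0 ∧ volume (B a) ≠ ∞) →
    (∀ a b, a ≠ b → e a = e b → Disjoint (B a) (B b)) →
    P⟦{ω | ∀ a, (T (e a).1 (e a).2 ω ∩ B a).encard = k a} | weightSigma w⟧ =ᵐ[P] fun ω =>
      ∏ a, (poissonMeasure
        (edgeRate (fun i => w i ω) (e a).1 (e a).2 * (volume (B a)).toNNReal)).real {k a}

section counts

variable {Ω : Type*} (T : ℕ → ℕ → Ω → Set ℝ) (t : ℝ) (ω : Ω)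

/-- The degree of the vertex `i` in the multigraph at time `t`, i.e. the number of points in
`[0, t]` of the union of the `T i j` over all `j`. -/
def vertexDegree (i : ℕ) : ℕ∞ := ((⋃ j, T i j ω) ∩ Set.Icc 0 t).encard

/-- The degree of the vertex `i` in the binary graph at time `t`, i.e. the number of vertices `j`
to which `i` is joined by at least one edge. -/
def binaryDegree (i : ℕ) : ℕ∞ := {j | 0 < (T i j ω ∩ Set.Icc 0 t).encard}.encard

/-- The number of active vertices (those of positive degree) at time `t`. -/
def numVertices : ℝ≥0∞ := ({i | 0 < vertexDegree T t ω i}.encard : ℕ∞)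

/-- The number of edges of the multigraph at time `t`. -/
def numEdges : ℝ≥0∞ := 2⁻¹ * ∑' i, (vertexDegree T t ω i : ℝ≥0∞)

/-- The number of edges of the binary graph at time `t`. -/
def numBinaryEdges : ℝ≥0∞ := 2⁻¹ * ∑' i, (binaryDegree T t ω i : ℝ≥0∞)

end counts

/-- The function `ℓ : (0, ∞) → [0, ∞)` is slowly varying at infinity. Values of `ℓ` outside
`(0, ∞)` play no role. -/
def IsSlowlyVarying (l : ℝ → ℝ) : Prop :=
  (∀ x, 0 < x → 0 ≤ l x) ∧ ∀ c, 0 < c → Tendsto (fun x => l (c * x) / l x) atTop (𝓝 1)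

/-- The tail of `ν` is regularly varying with exponent `α ∈ (0, 1)` and slowly varying function
`ℓ`: `ν [x, 1] ∼ x ^ (-α) ℓ(1 / x)` as `x → 0`, `x > 0`. -/
def HasRegularlyVaryingTail (ν : Measure unitInterval) (α : ℝ) (l : ℝ → ℝ) : Prop :=
  0 < α ∧ α < 1 ∧ IsSlowlyVarying l ∧
    (fun x : ℝ => ν.real {v : unitInterval | x ≤ (v : ℝ)}) ~[𝓝[>] 0]
      fun x : ℝ => x ^ (-α) * l x⁻¹

end

/-! Write H(x) = ν[x,1], F(x) = ∫_{v<x} v dν and m = ∫ v dν. Given the weights, all edge counts are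
Poisson, so each expectation is a sum over points, or pairs of points, of a function of the weights.
The first and second moment formulas (`sum_map_eq`, `sum_map_prodMk_eq`) turn such sums into
integrals against ν, and against ν ⊗ ν plus ν on the diagonal.

Edges: the expected count is at most n(m² + m), and a single pair i ≠ j with E[w_i w_j] > 0 already
contributes a multiple of n.

Vertices: the order is H(1/n). From above, vertex i is active with conditional probability 1 -
exp(-n w_i Σ_{j≠i} w_j), and `one_sub_exp_neg_mul_le` separates w_i from the other weights, leaving
∫ (1 - e^{-nv}) dν. From below, when some point has weight at least a, every point with weight in
[1/n, a) is active with conditional probability at least 1 - e^{-a}; the two point counts are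
independent.

Regular variation enters through H(x/2) ≤ c H(x) with c < 2 near 0, since 2^α < 2. Summing over
dyadic blocks gives F(x) ≤ C x H(x) (`exists_lowerMean_le`), hence ∫ (1 - e^{-nv}) dν = O(H(1/n)).

Binary edges: the expected count is at most the integral of 1 - e^{-nuv} over pairs. Cutting both
variables at n^{-1/2} in two ways bounds it by multiples of H(n^{-1/2}) √n and of H(n^{-1/2}) H(1/n)
(`exists_pairIntegral_le`). Substituting H(1/x) ~ x^α ℓ(x) finishes. -/

/-! ### Moments of the Poisson distribution -/

section PoissonMoments

/-- Size biasing: the weights satisfy (k + 1) p(k + 1) = r p(k), and the term k = 0 vanishes. Both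
moments below follow by choosing `f`. -/
theorem lintegral_mul_poissonMeasure (r : ℝ≥0) (f : ℕ → ℝ≥0∞) :
    ∫⁻ k, (k : ℝ≥0∞) * f k ∂(poissonMeasure r) = r * ∫⁻ k, f (k + 1) ∂(poissonMeasure r) := by
  rw [lintegral_countable', lintegral_countable', tsum_eq_zero_add' ENNReal.summable,
    ← ENNReal.tsum_mul_left]
  simp only [CharP.cast_eq_zero, zero_mul, zero_add, poissonMeasure_singleton]
  congr 1 with k
  have h : ((k + 1 : ℕ) : ℝ≥0∞) *
      ENNReal.ofReal (Real.exp (-r) * r ^ (k + 1) / (k + 1).factorial) =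
      r * ENNReal.ofReal (Real.exp (-r) * r ^ k / k.factorial) := by
    rw [← ENNReal.ofReal_natCast, ← ENNReal.ofReal_coe_nnreal, ← ENNReal.ofReal_mul (by positivity),
      ← ENNReal.ofReal_mul (by positivity)]
    congr 1
    rw [Nat.factorial_succ]
    push_cast
    field_simp
    ring
  rw [mul_right_comm, h, mul_right_comm, mul_assoc]

theorem lintegral_poissonMeasure_natCast (r : ℝ≥0) :
    ∫⁻ k, (k : ℝ≥0∞) ∂(poissonMeasure r) = r := by
  simpa using lintegral_mul_poissonMeasure r 1

theorem lintegral_poissonMeasure_natCast_sq (r : ℝ≥0) :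
    ∫⁻ k, (k : ℝ≥0∞) ^ 2 ∂(poissonMeasure r) = r * r + r := by
  simp_rw [sq]
  rw [lintegral_mul_poissonMeasure]
  simp [lintegral_add_right, lintegral_poissonMeasure_natCast, mul_add]

end PoissonMoments

/-! ### First and second moment measures of a Poisson point process -/

section Intensity

variable {S Ω : Type*} [MeasurableSpace S] [MeasurableSpace Ω] {ν : Measure S} {P : Measure Ω}
  {x : ℕ → Ω → S}

omit [MeasurableSpace S] [MeasurableSpace Ω] in
theorem encard_setOf_mem_eq_tsum (A : Set S) (ω : Ω) :
    (({i | x i ω ∈ A}.encard : ℕ∞) : ℝ≥0∞) = ∑' i, A.indicator (fun _ => (1 : ℝ≥0∞)) (x i ω) := by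
  rw [← ENNReal.tsum_set_one, tsum_subtype {i | x i ω ∈ A} fun _ => (1 : ℝ≥0∞)]
  rfl

/-- The Poisson law is prescribed only on sets of finite measure; by σ-finiteness these still
determine a measure. -/
theorem generateFrom_finite_measurableSet (ν : Measure S) [SigmaFinite ν] :
    MeasurableSpace.generateFrom {A | MeasurableSet A ∧ ν A ≠ ∞} = ‹MeasurableSpace S› := by
  apply le_antisymm (MeasurableSpace.generateFrom_le fun A hA => hA.1)
  intro A hA
  rw [← Set.inter_univ A, ← iUnion_spanningSets ν, Set.inter_iUnion]
  refine @MeasurableSet.iUnion _ _ (_) _ _ fun i => MeasurableSpace.measurableSet_generateFrom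
    ⟨hA.inter (measurableSet_spanningSets ν i), ?_⟩
  exact measure_ne_top_of_subset Set.inter_subset_right (measure_spanningSets_lt_top ν i).ne

theorem isPiSystem_finite_measurableSet (ν : Measure S) :
    IsPiSystem {A | MeasurableSet A ∧ ν A ≠ ∞} := fun _ hA _ hB _ =>
  ⟨hA.1.inter hB.1, measure_ne_top_of_subset Set.inter_subset_left hA.2⟩

namespace IsPoissonPointProcess

variable (h : IsPoissonPointProcess ν P x)
include h

theorem lintegral_encard_comp {A : Set S} (hA : MeasurableSet A) (hA' : ν A ≠ ∞)
    {f : ℝ≥0∞ → ℝ≥0∞} (hf : Measurable f) :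
    ∫⁻ ω, f (({i | x i ω ∈ A}.encard : ℕ∞) : ℝ≥0∞) ∂P =
      ∫⁻ k, f (k : ℝ≥0∞) ∂(poissonMeasure (ν A).toNNReal) := by
  have := (h.poisson A hA hA').lintegral_comp (f := fun k : ℕ∞ => f (k : ℝ≥0∞))
    (by fun_prop)
  rw [this, lintegral_map (by fun_prop) (by fun_prop)]
  simp

theorem lintegral_encard {A : Set S} (hA : MeasurableSet A) (hA' : ν A ≠ ∞) :
    ∫⁻ ω, (({i | x i ω ∈ A}.encard : ℕ∞) : ℝ≥0∞) ∂P = ν A := by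
  rw [h.lintegral_encard_comp (f := fun y => y) hA hA' measurable_id,
    lintegral_poissonMeasure_natCast, ENNReal.coe_toNNReal hA']

theorem lintegral_encard_sq {A : Set S} (hA : MeasurableSet A) (hA' : ν A ≠ ∞) :
    ∫⁻ ω, (({i | x i ω ∈ A}.encard : ℕ∞) : ℝ≥0∞) ^ 2 ∂P = ν A * ν A + ν A := by
  rw [h.lintegral_encard_comp (f := fun y => y ^ 2) hA hA' (by fun_prop),
    lintegral_poissonMeasure_natCast_sq, ENNReal.coe_toNNReal hA']

theorem measurable_encard {A : Set S} (hA : MeasurableSet A) :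
    Measurable fun ω => (({i | x i ω ∈ A}.encard : ℕ∞) : ℝ≥0∞) := by
  simp_rw [encard_setOf_mem_eq_tsum]
  exact .tsum fun i => (measurable_const.indicator hA).comp (h.measurable i)

theorem indepFun_encard {A B : Set S} (hA : MeasurableSet A) (hB : MeasurableSet B)
    (hAB : Disjoint A B) :
    IndepFun (fun ω => {i | x i ω ∈ A}.encard) (fun ω => {i | x i ω ∈ B}.encard) P := by
  have := (h.indep 2 ![A, B] (by simp [Fin.forall_fin_two, hA, hB])
    (by simp [Fin.forall_fin_two, hAB, hAB.symm])).indepFun (i := 0) (j := 1) (by simp)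
  simpa using this

theorem lintegral_encard_mul_of_disjoint {A B : Set S} (hA : MeasurableSet A) (hA' : ν A ≠ ∞)
    (hB : MeasurableSet B) (hB' : ν B ≠ ∞) (hAB : Disjoint A B) :
    ∫⁻ ω, (({i | x i ω ∈ A}.encard : ℕ∞) : ℝ≥0∞) * (({i | x i ω ∈ B}.encard : ℕ∞) : ℝ≥0∞) ∂P =
      ν A * ν B := by
  have hi := (h.indepFun_encard hA hB hAB).comp (φ := fun k : ℕ∞ => (k : ℝ≥0∞))
    (ψ := fun k : ℕ∞ => (k : ℝ≥0∞)) (by fun_prop) (by fun_prop)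
  have := lintegral_mul_eq_lintegral_mul_lintegral_of_indepFun (h.measurable_encard hA)
    (h.measurable_encard hB) hi
  rw [h.lintegral_encard hA hA', h.lintegral_encard hB hB'] at this
  exact this

/-- Split both sets along A ∩ B, A \ B and B \ A. All cross products are of independent counts; only
the square of the count in A ∩ B is not, and its Poisson variance is the extra term. -/
theorem lintegral_encard_mul {A B : Set S} (hA : MeasurableSet A) (hA' : ν A ≠ ∞)
    (hB : MeasurableSet B) (hB' : ν B ≠ ∞) :
    ∫⁻ ω, (({i | x i ω ∈ A}.encard : ℕ∞) : ℝ≥0∞) * (({i | x i ω ∈ B}.encard : ℕ∞) : ℝ≥0∞) ∂P =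
      ν A * ν B + ν (A ∩ B) := by
  set X : Set S → Ω → ℝ≥0∞ := fun A ω => (({i | x i ω ∈ A}.encard : ℕ∞) : ℝ≥0∞) with hX
  have hadd : ∀ A B : Set S, ∀ ω, X A ω = X (A ∩ B) ω + X (A \ B) ω := by
    intro A B ω
    simp only [hX, encard_setOf_mem_eq_tsum]
    rw [← ENNReal.tsum_add]
    congr 1 with i
    by_cases h1 : x i ω ∈ A <;> by_cases h2 : x i ω ∈ B <;> simp [h1, h2]
  have hC := hA.inter hB
  have hD := hA.diff hB
  have hE := hB.diff hA
  have hC' : ν (A ∩ B) ≠ ∞ := measure_ne_top_of_subset Set.inter_subset_left hA'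
  have hD' : ν (A \ B) ≠ ∞ := measure_ne_top_of_subset Set.sdiff_subset hA'
  have hE' : ν (B \ A) ≠ ∞ := measure_ne_top_of_subset Set.sdiff_subset hB'
  have hm := fun {A : Set S} (hA : MeasurableSet A) => h.measurable_encard hA
  calc ∫⁻ ω, X A ω * X B ω ∂P
      = ∫⁻ ω, (X (A ∩ B) ω ^ 2 + X (A ∩ B) ω * X (B \ A) ω) +
          (X (A \ B) ω * X (A ∩ B) ω + X (A \ B) ω * X (B \ A) ω) ∂P := by
        congr 1 with ω
        rw [hadd A B, hadd B A, Set.inter_comm B A]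
        ring
    _ = (ν (A ∩ B) * ν (A ∩ B) + ν (A ∩ B) + ν (A ∩ B) * ν (B \ A)) +
          (ν (A \ B) * ν (A ∩ B) + ν (A \ B) * ν (B \ A)) := by
        have hXm : ∀ {A : Set S}, MeasurableSet A → Measurable (X A) := hm
        rw [lintegral_add_left (by fun_prop (disch := assumption)),
          lintegral_add_left (by fun_prop (disch := assumption)),
          lintegral_add_left (by fun_prop (disch := assumption)),
          h.lintegral_encard_sq hC hC',
          h.lintegral_encard_mul_of_disjoint hC hC' hE hE'
            (Set.disjoint_sdiff_right.mono_left Set.inter_subset_left),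
          h.lintegral_encard_mul_of_disjoint hD hD' hC hC'
            (Set.disjoint_sdiff_left.mono_right Set.inter_subset_right),
          h.lintegral_encard_mul_of_disjoint hD hD' hE hE'
            (Set.disjoint_sdiff_left.mono_right Set.sdiff_subset)]
    _ = ν A * ν B + ν (A ∩ B) := by
        rw [← measure_inter_add_sdiff A hB, ← measure_inter_add_sdiff B hA, Set.inter_comm B A]
        ring

/-- Campbell's formula. -/
theorem sum_map_eq [SigmaFinite ν] : Measure.sum (fun i => P.map (x i)) = ν := by
  symm
  -- Uniqueness on a π-system with a σ-finite exhaustion: it remains to compare both measures on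
  -- sets of finite measure.
  refine Measure.ext_of_generateFrom_of_iUnion _ (spanningSets ν)
    (generateFrom_finite_measurableSet ν).symm (isPiSystem_finite_measurableSet ν)
    (iUnion_spanningSets ν)
    (fun i => ⟨measurableSet_spanningSets ν i, (measure_spanningSets_lt_top ν i).ne⟩)
    (fun i => (measure_spanningSets_lt_top ν i).ne) ?_
  rintro A ⟨hA, hA'⟩
  rw [Measure.sum_apply _ hA, ← h.lintegral_encard hA hA']
  simp_rw [encard_setOf_mem_eq_tsum]
  rw [lintegral_tsum fun i => (Measurable.aemeasurable
    (f := fun ω => A.indicator (fun _ => (1 : ℝ≥0∞)) (x i ω))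
    ((measurable_const.indicator hA).comp (h.measurable i)))]
  congr 1 with i
  rw [Measure.map_apply (h.measurable i) hA, ← lintegral_indicator_one (h.measurable i hA)]
  rfl

/-- The second moment formula: the intensity of the process of pairs of points, including the
diagonal. -/
theorem sum_map_prodMk_eq [SigmaFinite ν] :
    Measure.sum (fun p : ℕ × ℕ => P.map fun ω => (x p.1 ω, x p.2 ω)) =
      ν.prod ν + ν.map fun v => (v, v) := by
  have hdiag : Measurable fun v : S => (v, v) := by fun_prop
  have hrect : ∀ A B : Set S, MeasurableSet A → MeasurableSet B →
      (ν.prod ν + ν.map fun v => (v, v)) (A ×ˢ B) = ν A * ν B + ν (A ∩ B) := by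
    intro A B hA hB
    rw [Measure.add_apply, Measure.prod_prod, Measure.map_apply hdiag (hA.prod hB)]
    rfl
  have hspan : IsCountablySpanning {A | MeasurableSet A ∧ ν A ≠ ∞} :=
    ⟨spanningSets ν, fun i => ⟨measurableSet_spanningSets ν i, (measure_spanningSets_lt_top ν i).ne⟩,
      iUnion_spanningSets ν⟩
  symm
  refine Measure.ext_of_generateFrom_of_iUnion _ (fun i => spanningSets ν i ×ˢ spanningSets ν i)
    (generateFrom_eq_prod (generateFrom_finite_measurableSet ν)
      (generateFrom_finite_measurableSet ν) hspan hspan).symm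
    ((isPiSystem_finite_measurableSet ν).prod (isPiSystem_finite_measurableSet ν)) ?_
    (fun i => ⟨_, ⟨measurableSet_spanningSets ν i, (measure_spanningSets_lt_top ν i).ne⟩, _,
      ⟨measurableSet_spanningSets ν i, (measure_spanningSets_lt_top ν i).ne⟩, rfl⟩) ?_ ?_
  · rw [Set.iUnion_prod_of_monotone (monotone_spanningSets ν) (monotone_spanningSets ν),
      iUnion_spanningSets, Set.univ_prod_univ]
  · intro i
    rw [hrect _ _ (measurableSet_spanningSets ν i) (measurableSet_spanningSets ν i), Set.inter_self]
    have := (measure_spanningSets_lt_top ν i).ne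
    finiteness
  · rintro _ ⟨A, ⟨hA, hA'⟩, B, ⟨hB, hB'⟩, rfl⟩
    rw [hrect A B hA hB, ← h.lintegral_encard_mul hA hA' hB hB', Measure.sum_apply _ (hA.prod hB)]
    have hmA : ∀ i, Measurable fun ω => A.indicator (fun _ => (1 : ℝ≥0∞)) (x i ω) := fun i =>
      (measurable_const.indicator hA).comp (h.measurable i)
    have hmB : ∀ i, Measurable fun ω => B.indicator (fun _ => (1 : ℝ≥0∞)) (x i ω) := fun i =>
      (measurable_const.indicator hB).comp (h.measurable i)
    simp_rw [encard_setOf_mem_eq_tsum, ← ENNReal.tsum_mul_right, ← ENNReal.tsum_mul_left]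
    rw [lintegral_tsum fun i => by fun_prop, ENNReal.tsum_prod']
    congr 1 with i
    rw [lintegral_tsum fun j => by fun_prop]
    congr 1 with j
    have hm : Measurable fun ω => (x i ω, x j ω) := (h.measurable i).prodMk (h.measurable j)
    rw [Measure.map_apply hm (hA.prod hB), ← lintegral_indicator_one (hm (hA.prod hB))]
    congr 1 with ω
    by_cases h1 : x i ω ∈ A <;> by_cases h2 : x j ω ∈ B <;> simp [h1, h2]

theorem lintegral_tsum_comp [SigmaFinite ν] {f : S → ℝ≥0∞} (hf : Measurable f) :
    ∑' i, ∫⁻ ω, f (x i ω) ∂P = ∫⁻ v, f v ∂ν := by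
  conv_rhs => rw [← h.sum_map_eq]
  rw [lintegral_sum_measure]
  simp_rw [lintegral_map hf (h.measurable _)]

theorem lintegral_tsum_comp₂ [SigmaFinite ν] {f : S × S → ℝ≥0∞} (hf : Measurable f) :
    ∑' i, ∑' j, ∫⁻ ω, f (x i ω, x j ω) ∂P =
      ∫⁻ u, ∫⁻ v, f (u, v) ∂ν ∂ν + ∫⁻ v, f (v, v) ∂ν := by
  have hdiag : Measurable fun v : S => (v, v) := by fun_prop
  rw [← lintegral_prod _ hf.aemeasurable, ← lintegral_map hf hdiag, ← lintegral_add_measure,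
    ← h.sum_map_prodMk_eq, lintegral_sum_measure, ENNReal.tsum_prod']
  simp_rw [lintegral_map hf ((h.measurable _).prodMk (h.measurable _))]

end IsPoissonPointProcess
end Intensity

/-! ### Unconditional laws of the edge counts -/

section GraphLaw

variable {Ω : Type*} [MeasurableSpace Ω] {ν : Measure unitInterval} {P : Measure Ω}
  {w : ℕ → Ω → unitInterval} {T : ℕ → ℕ → Ω → Set ℝ}

theorem measurable_edgeRate (hw : ∀ i, Measurable (w i)) (i j : ℕ) :
    Measurable fun ω => edgeRate (fun i => w i ω) i j := by
  have hc : Measurable unitInterval.toNNReal := unitInterval.toNNReal_continuous.measurable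
  unfold edgeRate
  split_ifs
  · exact measurable_const
  · exact (hc.comp (hw i)).mul (hc.comp (hw j))

theorem edgeRate_comm (u : ℕ → unitInterval) (i j : ℕ) : edgeRate u i j = edgeRate u j i := by
  unfold edgeRate
  simp only [eq_comm (a := i), mul_comm (unitInterval.toNNReal (u i))]

namespace IsPoissonizedGraph

variable (hG : IsPoissonizedGraph ν P w T)
include hG

/-- Integrating the conditional probability over the weights gives the unconditional one. -/
theorem measure_counts [IsProbabilityMeasure P] {m : ℕ} (e : Fin m → ℕ × ℕ) (B : Fin m → Set ℝ)
    (k : Fin m → ℕ) (he : ∀ a, (e a).1 ≤ (e a).2)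
    (hB : ∀ a, MeasurableSet (B a) ∧ B a ⊆ Set.Ici 0 ∧ volume (B a) ≠ ∞)
    (hd : ∀ a b, a ≠ b → e a = e b → Disjoint (B a) (B b)) :
    P {ω | ∀ a, (T (e a).1 (e a).2 ω ∩ B a).encard = k a} =
      ∫⁻ ω, ∏ a, poissonMeasure (edgeRate (fun i => w i ω) (e a).1 (e a).2 *
        (volume (B a)).toNNReal) {k a} ∂P := by
  have hms : MeasurableSet {ω | ∀ a, (T (e a).1 (e a).2 ω ∩ B a).encard = k a} := by
    rw [Set.ofPred_forall]
    exact .iInter fun a => hG.measurable _ _ _ (hB a).1 (measurableSet_singleton _)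
  have hle : weightSigma w ≤ ‹MeasurableSpace Ω› :=
    (measurable_pi_lambda _ hG.weights.measurable).comap_le
  have hlaw := hG.conditional_law m e B k he hB hd
  have hint : Integrable (fun ω => ∏ a, (poissonMeasure
      (edgeRate (fun i => w i ω) (e a).1 (e a).2 * (volume (B a)).toNNReal)).real {k a}) P :=
    integrable_condExp.congr hlaw
  have h1 : P.real {ω | ∀ a, (T (e a).1 (e a).2 ω ∩ B a).encard = k a} =
      ∫ ω, ∏ a, (poissonMeasure
        (edgeRate (fun i => w i ω) (e a).1 (e a).2 * (volume (B a)).toNNReal)).real {k a} ∂P := by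
    rw [← integral_congr_ae hlaw, integral_condExp hle, integral_indicator_const _ hms]
    simp
  rw [← ENNReal.ofReal_toReal (measure_ne_top P _), ← measureReal_def, h1,
    ofReal_integral_eq_lintegral_ofReal hint (.of_forall fun ω => by positivity)]
  congr 1 with ω
  rw [ENNReal.ofReal_prod_of_nonneg (fun _ _ => by positivity)]
  simp

/-- The expected number of points of a single edge process. -/
theorem lintegral_encard_inter_Icc [IsProbabilityMeasure P] (i j n : ℕ) :
    ∫⁻ ω, ((T i j ω ∩ Set.Icc 0 (n : ℝ)).encard : ℝ≥0∞) ∂P =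
      ∫⁻ ω, n * (edgeRate (fun i => w i ω) i j : ℝ≥0∞) ∂P := by
  wlog hij : i ≤ j generalizing i j
  · simp_rw [hG.symm j i, edgeRate_comm _ i j]
    exact this j i (by omega)
  set X : Ω → ℕ∞ := fun ω => (T i j ω ∩ Set.Icc 0 (n : ℝ)).encard with hX
  have hXm : Measurable X := hG.measurable _ _ _ measurableSet_Icc
  have hXs : ∀ k : ℕ, MeasurableSet {ω | X ω = k} := fun k => hXm (measurableSet_singleton _)
  set r : Ω → ℝ≥0 := fun ω => edgeRate (fun i => w i ω) i j * n with hr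
  have hrm : Measurable r := (measurable_edgeRate hG.weights.measurable i j).mul_const _
  have hlaw : ∀ k : ℕ, P {ω | X ω = k} = ∫⁻ ω, poissonMeasure (r ω) {k} ∂P := by
    intro k
    have := hG.measure_counts (m := 1) (fun _ => (i, j)) (fun _ => Set.Icc 0 (n : ℝ)) (fun _ => k)
      (fun _ => hij) (fun _ => ⟨measurableSet_Icc, Set.Icc_subset_Ici_self, by simp⟩)
      (fun a b hab => (hab (Subsingleton.elim a b)).elim)
    simpa [hX, hr] using this
  have hpm : ∀ k : ℕ, Measurable fun ω => poissonMeasure (r ω) {k} := by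
    intro k
    simp_rw [poissonMeasure_singleton]
    fun_prop
  -- The conditional law speaks only of finite counts. Their probabilities already add up to 1,
  -- which rules out infinitely many points almost surely.
  have hsum : ∑' k : ℕ, P {ω | X ω = k} = 1 := by
    simp_rw [hlaw]
    rw [← lintegral_tsum fun k => (hpm k).aemeasurable]
    have : ∀ ω, ∑' k : ℕ, poissonMeasure (r ω) {k} = 1 := fun ω => by
      have := lintegral_countable' (μ := poissonMeasure (r ω)) (fun _ : ℕ => (1 : ℝ≥0∞))
      simpa using this.symm
    simp [this]
  have hfin : ∀ᵐ ω ∂P, X ω ≠ ⊤ := by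
    have hU : P (⋃ k : ℕ, {ω | X ω = k}) = 1 := by
      rw [measure_iUnion, hsum]
      · intro a b hab
        refine Set.disjoint_left.2 fun ω (ha : X ω = a) (hb : X ω = b) => hab ?_
        exact_mod_cast ha.symm.trans hb
      · exact hXs
    have hae : ∀ᵐ ω ∂P, ω ∈ ⋃ k : ℕ, {ω | X ω = k} := by
      rw [← prob_compl_eq_zero_iff (.iUnion hXs)] at hU
      exact hU
    filter_upwards [hae] with ω hω
    obtain ⟨k, hk⟩ := Set.mem_iUnion.1 hω
    have hk : X ω = k := hk
    simp [hk]
  have hXsum : ∀ᵐ ω ∂P, (X ω : ℝ≥0∞) =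
      ∑' k : ℕ, (k : ℝ≥0∞) * {ω | X ω = k}.indicator (fun _ => (1 : ℝ≥0∞)) ω := by
    filter_upwards [hfin] with ω hω
    obtain ⟨k, hk⟩ := ENat.ne_top_iff_exists.1 hω
    rw [tsum_eq_single k]
    · simp [← hk]
    · intro b hb
      have : ¬ X ω = b := by rw [← hk]; exact_mod_cast hb.symm
      simp [this]
  rw [lintegral_congr_ae hXsum, lintegral_tsum fun k => ((measurable_const.indicator
    (hXs k)).const_mul _).aemeasurable]
  have hterm : ∀ k : ℕ, ∫⁻ ω, (k : ℝ≥0∞) *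
      {ω | X ω = k}.indicator (fun _ => (1 : ℝ≥0∞)) ω ∂P =
      ∫⁻ ω, (k : ℝ≥0∞) * poissonMeasure (r ω) {k} ∂P := by
    intro k
    rw [lintegral_const_mul _ (measurable_const.indicator (hXs k)),
      lintegral_const_mul _ (hpm k), ← hlaw]
    congr 1
    exact lintegral_indicator_one (hXs k)
  simp_rw [hterm]
  rw [← lintegral_tsum fun k => ((hpm k).const_mul _).aemeasurable]
  congr 1 with ω
  rw [← lintegral_countable', lintegral_poissonMeasure_natCast, hr]
  push_cast
  ring

/-- The probability that no vertex of `s` is joined to `i` at time `n`. -/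
theorem measure_forall_inter_Icc_eq_empty [IsProbabilityMeasure P] (i n : ℕ) (s : Finset ℕ) :
    P {ω | ∀ j ∈ s, T i j ω ∩ Set.Icc 0 (n : ℝ) = ∅} =
      ∫⁻ ω, ENNReal.ofReal (Real.exp (-(n * ∑ j ∈ s, edgeRate (fun i => w i ω) i j))) ∂P := by
  -- The conditional law requires ordered index pairs, hence the passage to `min` and `max`.
  have hset : {ω | ∀ j ∈ s, T i j ω ∩ Set.Icc 0 (n : ℝ) = ∅} = {ω | ∀ a : Fin s.card,
      (T (min i (s.equivFin.symm a)) (max i (s.equivFin.symm a)) ω ∩ Set.Icc 0 (n : ℝ)).encard =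
        (0 : ℕ)} := by
    have hT : ∀ j ω, T (min i j) (max i j) ω = T i j ω := by
      intro j ω
      rcases le_total i j with h | h <;> simp [h, hG.symm i j]
    ext ω
    simp only [Set.mem_ofPred_eq, hT, Nat.cast_zero, Set.encard_eq_zero]
    refine ⟨fun h a => h _ (s.equivFin.symm a).2, fun h j hj => ?_⟩
    simpa using h (s.equivFin ⟨j, hj⟩)
  have he : ∀ (u : ℕ → unitInterval) j, edgeRate u (min i j) (max i j) = edgeRate u i j := by
    intro u j
    rcases le_total i j with h | h <;> simp [h, edgeRate_comm u i j]
  rw [hset, hG.measure_counts (fun a : Fin s.card => (min i (s.equivFin.symm a : ℕ),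
    max i (s.equivFin.symm a : ℕ))) (fun _ => Set.Icc 0 (n : ℝ)) (fun _ => 0)
    (fun a => min_le_max)
    (fun _ => ⟨measurableSet_Icc, Set.Icc_subset_Ici_self, by simp⟩) ?_]
  · congr 1 with ω
    simp only [poissonMeasure_singleton, he]
    rw [← ENNReal.ofReal_prod_of_nonneg fun _ _ => by positivity]
    congr 1
    simp only [pow_zero, mul_one, Nat.factorial_zero, Nat.cast_one, div_one]
    rw [← Real.exp_sum, Finset.sum_neg_distrib, Real.volume_Icc, NNReal.coe_sum, Finset.mul_sum]
    congr 2
    rw [s.equivFin.symm.sum_comp (fun j : s => ((edgeRate (fun i => w i ω) i j *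
      (ENNReal.ofReal (n - 0)).toNNReal : ℝ≥0) : ℝ)),
      Finset.sum_coe_sort s (fun j => ((edgeRate (fun i => w i ω) i j *
      (ENNReal.ofReal (n - 0)).toNNReal : ℝ≥0) : ℝ))]
    refine Finset.sum_congr rfl fun j _ => ?_
    simp [mul_comm]
  -- For fixed i, the pair (min, max) determines j, so no edge process is listed twice.
  · intro a b hab h
    exfalso
    apply hab
    apply s.equivFin.symm.injective
    apply Subtype.ext
    simp only [Prod.mk.injEq] at h
    omega

end IsPoissonizedGraph
end GraphLaw

/-! ### Bounds for the expected numbers of edges and vertices -/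

section Expectations

/-- For c ≤ 1 this is monotonicity; for c ≥ 1, Bernoulli's inequality applied to (e^{-x})^c gives
the factor c. With c the total weight of the other vertices, the bound is affine in c, so the second
moment formula applies. -/
theorem one_sub_exp_neg_mul_le {c x : ℝ} (hc : 0 ≤ c) (hx : 0 ≤ x) :
    1 - Real.exp (-(x * c)) ≤ (1 + c) * (1 - Real.exp (-x)) := by
  have h0 : Real.exp (-x) ≤ 1 := Real.exp_le_one_iff.2 (by linarith)
  rcases le_total c 1 with h | h
  · have h1 : Real.exp (-x) ≤ Real.exp (-(x * c)) := Real.exp_le_exp.2 (by nlinarith)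
    nlinarith
  · have h1 := one_add_mul_self_le_rpow_one_add (s := Real.exp (-x) - 1)
      (by linarith [Real.exp_pos (-x)]) h
    rw [add_sub_cancel, ← Real.exp_mul, neg_mul] at h1
    nlinarith

theorem coe_encard_iUnion_le {ι α : Type*} (s : ι → Set α) :
    (((⋃ i, s i).encard : ℕ∞) : ℝ≥0∞) ≤ ∑' i, ((s i).encard : ℝ≥0∞) := by
  simp_rw [← ENNReal.tsum_set_one]
  exact ENNReal.tsum_iUnion_le_tsum (fun _ => 1) s

theorem coe_encard_setOf {ι : Type*} (p : ι → Prop) [DecidablePred p] :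
    (({i | p i}.encard : ℕ∞) : ℝ≥0∞) = ∑' i, if p i then 1 else 0 := by
  rw [← ENNReal.tsum_set_one, tsum_subtype {i | p i} fun _ => (1 : ℝ≥0∞)]
  congr 1 with i
  simp [Set.indicator_apply]

theorem edgeRate_le (u : ℕ → unitInterval) (i j : ℕ) :
    edgeRate u i j ≤ unitInterval.toNNReal (u i) * unitInterval.toNNReal (u j) := by
  unfold edgeRate
  split_ifs
  · exact zero_le
  · exact le_rfl

theorem coe_toNNReal_eq_ofReal (v : unitInterval) :
    ((unitInterval.toNNReal v : ℝ≥0) : ℝ≥0∞) = ENNReal.ofReal (v : ℝ) := by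
  rw [← ENNReal.ofReal_coe_nnreal, unitInterval.coe_toNNReal]

theorem lintegral_ofReal_mul_le (ν : Measure unitInterval) (f : unitInterval → ℝ≥0∞) :
    ∫⁻ v, f v * ENNReal.ofReal (v : ℝ) ∂ν ≤ ∫⁻ v, f v ∂ν :=
  lintegral_mono fun v => mul_le_of_le_one_right' (ENNReal.ofReal_le_one.2 v.2.2)

variable {Ω : Type*} [MeasurableSpace Ω] {ν : Measure unitInterval} {P : Measure Ω}
  {w : ℕ → Ω → unitInterval} {T : ℕ → ℕ → Ω → Set ℝ}

/-- If every off-diagonal term vanished, the second moment formula would read ∫ v² = (∫ v)² + ∫ v².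
Since ∫ v² is finite it cancels, so v = 0 almost everywhere, which is impossible for a nonzero ν
without an atom at 0. -/
theorem IsPoissonPointProcess.exists_lintegral_mul_pos [SigmaFinite ν] [NullSingletonClass ν]
    (hν : ν ≠ 0) (hν_mean : ∫⁻ v, ENNReal.ofReal (v : ℝ) ∂ν < ∞)
    (hw : IsPoissonPointProcess ν P w) :
    ∃ i j, i ≠ j ∧ 0 < ∫⁻ ω, ENNReal.ofReal (w i ω : ℝ) * ENNReal.ofReal (w j ω : ℝ) ∂P := by
  by_contra! hcon
  have hm : Measurable fun v : unitInterval => ENNReal.ofReal (v : ℝ) := by fun_prop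
  have h2 := hw.lintegral_tsum_comp₂
    (f := fun p => ENNReal.ofReal (p.1 : ℝ) * ENNReal.ofReal (p.2 : ℝ)) (by fun_prop)
  have h1 := hw.lintegral_tsum_comp
    (f := fun v => ENNReal.ofReal (v : ℝ) * ENNReal.ofReal (v : ℝ)) (by fun_prop)
  have h3 : ∀ i, ∑' j, ∫⁻ ω, ENNReal.ofReal (w i ω : ℝ) * ENNReal.ofReal (w j ω : ℝ) ∂P =
      ∫⁻ ω, ENNReal.ofReal (w i ω : ℝ) * ENNReal.ofReal (w i ω : ℝ) ∂P := fun i =>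
    tsum_eq_single i fun j hj => le_zero_iff.1 (hcon i j hj.symm)
  simp_rw [h3, h1, lintegral_const_mul _ hm, lintegral_mul_const _ hm] at h2
  have hfin : ∫⁻ v, ENNReal.ofReal (v : ℝ) * ENNReal.ofReal (v : ℝ) ∂ν ≠ ∞ :=
    ((lintegral_ofReal_mul_le ν _).trans_lt hν_mean).ne
  have h4 : (∫⁻ v, ENNReal.ofReal (v : ℝ) ∂ν) * ∫⁻ v, ENNReal.ofReal (v : ℝ) ∂ν = 0 := by
    symm
    refine (ENNReal.add_left_inj hfin).1 ?_
    rw [zero_add]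
    exact h2
  rw [mul_self_eq_zero, lintegral_eq_zero_iff hm] at h4
  apply hν
  rw [← Measure.measure_univ_eq_zero]
  have h5 : ∀ᵐ v ∂ν, v ≠ (0 : unitInterval) := by
    rw [ae_iff]
    simp
  have h6 : ∀ᵐ _v : unitInterval ∂ν, False := by
    filter_upwards [h4, h5] with v hv hv'
    have : (v : ℝ) ≤ 0 := ENNReal.ofReal_eq_zero.1 hv
    exact hv' (le_antisymm this v.2.1)
  simpa [ae_iff] using h6

namespace IsPoissonizedGraph

variable [IsProbabilityMeasure P] (hG : IsPoissonizedGraph ν P w T)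
include hG

theorem lintegral_numEdges_le [SigmaFinite ν] (n : ℕ) :
    ∫⁻ ω, numEdges T n ω ∂P ≤ n * ((∫⁻ v, ENNReal.ofReal (v : ℝ) ∂ν) *
      (∫⁻ v, ENNReal.ofReal (v : ℝ) ∂ν) + ∫⁻ v, ENNReal.ofReal (v : ℝ) ∂ν) := by
  have hm : Measurable fun v : unitInterval => ENNReal.ofReal (v : ℝ) := by fun_prop
  have hT : ∀ i j, Measurable fun ω => ((T i j ω ∩ Set.Icc 0 (n : ℝ)).encard : ℝ≥0∞) :=
    fun i j => (measurable_of_countable (fun k : ℕ∞ => (k : ℝ≥0∞))).comp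
      (hG.measurable i j _ measurableSet_Icc)
  calc ∫⁻ ω, numEdges T n ω ∂P
      ≤ ∫⁻ ω, ∑' i, ∑' j, ((T i j ω ∩ Set.Icc 0 (n : ℝ)).encard : ℝ≥0∞) ∂P := by
        refine lintegral_mono fun ω => ?_
        refine (mul_le_of_le_one_left' (by simp)).trans (ENNReal.tsum_le_tsum fun i => ?_)
        rw [vertexDegree, Set.iUnion_inter]
        exact coe_encard_iUnion_le _
    _ = ∑' i, ∑' j, ∫⁻ ω, n * (edgeRate (fun i => w i ω) i j : ℝ≥0∞) ∂P := by
        rw [lintegral_tsum fun i => (Measurable.tsum fun j => hT i j).aemeasurable]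
        simp_rw [lintegral_tsum fun j => (hT _ j).aemeasurable, hG.lintegral_encard_inter_Icc]
    _ ≤ ∑' i, ∑' j, ∫⁻ ω, n * (ENNReal.ofReal (w i ω : ℝ) * ENNReal.ofReal (w j ω : ℝ)) ∂P := by
        gcongr with i j ω
        rw [← coe_toNNReal_eq_ofReal, ← coe_toNNReal_eq_ofReal]
        exact_mod_cast edgeRate_le _ i j
    _ = n * ((∫⁻ v, ENNReal.ofReal (v : ℝ) ∂ν) * (∫⁻ v, ENNReal.ofReal (v : ℝ) ∂ν) +
          ∫⁻ v, ENNReal.ofReal (v : ℝ) * ENNReal.ofReal (v : ℝ) ∂ν) := by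
        rw [hG.weights.lintegral_tsum_comp₂
          (f := fun p => n * (ENNReal.ofReal (p.1 : ℝ) * ENNReal.ofReal (p.2 : ℝ))) (by fun_prop)]
        simp only
        simp_rw [lintegral_const_mul _ (hm.const_mul _), lintegral_const_mul _ hm]
        rw [lintegral_const_mul _ (by fun_prop), lintegral_mul_const _ hm,
          lintegral_const_mul _ (by fun_prop), mul_add]
    _ ≤ _ := by
        exact mul_le_mul_right (add_le_add_right (lintegral_ofReal_mul_le ν _) _) _

theorem exists_mul_le_lintegral_numEdges [SigmaFinite ν] [NullSingletonClass ν]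
    (hν : ν ≠ 0) (hν_mean : ∫⁻ v, ENNReal.ofReal (v : ℝ) ∂ν < ∞) :
    ∃ c : ℝ≥0∞, 0 < c ∧ ∀ n : ℕ, n * c ≤ ∫⁻ ω, numEdges T n ω ∂P := by
  obtain ⟨i, j, hij, hpos⟩ := hG.weights.exists_lintegral_mul_pos hν hν_mean
  refine ⟨2⁻¹ * ∫⁻ ω, ENNReal.ofReal (w i ω : ℝ) * ENNReal.ofReal (w j ω : ℝ) ∂P,
    ENNReal.mul_pos (by simp) hpos.ne', fun n => ?_⟩
  have hw := hG.weights.measurable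
  calc n * (2⁻¹ * ∫⁻ ω, ENNReal.ofReal (w i ω : ℝ) * ENNReal.ofReal (w j ω : ℝ) ∂P)
      = ∫⁻ ω, 2⁻¹ * ((T i j ω ∩ Set.Icc 0 (n : ℝ)).encard : ℝ≥0∞) ∂P := by
        rw [lintegral_const_mul' _ _ (by simp), hG.lintegral_encard_inter_Icc,
          lintegral_const_mul' _ _ (by simp), mul_left_comm]
        simp_rw [edgeRate, if_neg hij, ENNReal.coe_mul, coe_toNNReal_eq_ofReal]
    _ ≤ ∫⁻ ω, numEdges T n ω ∂P := by
        refine lintegral_mono fun ω => ?_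
        refine mul_le_mul_right (le_trans ?_ (ENNReal.le_tsum i)) _
        have : (T i j ω ∩ Set.Icc 0 (n : ℝ)).encard ≤ vertexDegree T n ω i :=
          Set.encard_le_encard (Set.inter_subset_inter_left _ (Set.subset_iUnion (fun j => T i j ω) j))
        exact_mod_cast this

theorem measure_exists_inter_Icc_ne_empty (i n : ℕ) (s : Finset ℕ) :
    P {ω | ∃ j ∈ s, T i j ω ∩ Set.Icc 0 (n : ℝ) ≠ ∅} =
      ∫⁻ ω, ENNReal.ofReal (1 - Real.exp (-(n * ∑ j ∈ s, edgeRate (fun i => w i ω) i j))) ∂P := by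
  have hmeas : MeasurableSet {ω | ∀ j ∈ s, T i j ω ∩ Set.Icc 0 (n : ℝ) = ∅} := by
    have : {ω | ∀ j ∈ s, T i j ω ∩ Set.Icc 0 (n : ℝ) = ∅} =
        ⋂ j ∈ s, {ω | (T i j ω ∩ Set.Icc 0 (n : ℝ)).encard = 0} := by
      ext ω
      simp
    rw [this]
    exact s.measurableSet_biInter fun j _ =>
      hG.measurable i j _ measurableSet_Icc (measurableSet_singleton 0)
  have hr : Measurable fun ω => ((∑ j ∈ s, edgeRate (fun i => w i ω) i j : ℝ≥0) : ℝ) :=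
    (Finset.measurable_sum s fun j _ =>
      measurable_edgeRate hG.weights.measurable i j).coe_nnreal_real
  have hcompl : {ω | ∃ j ∈ s, T i j ω ∩ Set.Icc 0 (n : ℝ) ≠ ∅} =
      {ω | ∀ j ∈ s, T i j ω ∩ Set.Icc 0 (n : ℝ) = ∅}ᶜ := by
    ext ω
    simp
  rw [hcompl, prob_compl_eq_one_sub hmeas, hG.measure_forall_inter_Icc_eq_empty]
  have hone : ∀ ω, ENNReal.ofReal
      (1 - Real.exp (-(n * ∑ j ∈ s, edgeRate (fun i => w i ω) i j : ℝ))) =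
      1 - ENNReal.ofReal (Real.exp (-(n * ∑ j ∈ s, edgeRate (fun i => w i ω) i j : ℝ))) := by
    intro ω
    rw [ENNReal.ofReal_sub _ (Real.exp_pos _).le, ENNReal.ofReal_one]
  have hle : ∀ ω, ENNReal.ofReal
      (Real.exp (-(n * ∑ j ∈ s, edgeRate (fun i => w i ω) i j : ℝ))) ≤ 1 := fun ω =>
    ENNReal.ofReal_le_one.2 (Real.exp_le_one_iff.2 (neg_nonpos.2 (by positivity)))
  simp_rw [hone]
  rw [lintegral_sub (by fun_prop) _ (.of_forall hle)]
  · simp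
  · refine ne_top_of_le_ne_top ENNReal.one_ne_top
      ((lintegral_mono hle).trans ?_)
    simp

omit [IsProbabilityMeasure P] in
theorem measurableSet_inter_Icc_ne_empty (i j n : ℕ) :
    MeasurableSet {ω | T i j ω ∩ Set.Icc 0 (n : ℝ) ≠ ∅} := by
  have : {ω | T i j ω ∩ Set.Icc 0 (n : ℝ) ≠ ∅} =
      {ω | (T i j ω ∩ Set.Icc 0 (n : ℝ)).encard = 0}ᶜ := by
    ext ω
    simp
  rw [this]
  exact (hG.measurable i j _ measurableSet_Icc (measurableSet_singleton 0)).compl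

omit hG [IsProbabilityMeasure P] [MeasurableSpace Ω] in
theorem vertexDegree_pos_iff (i n : ℕ) (ω : Ω) :
    0 < vertexDegree T n ω i ↔ ∃ j, T i j ω ∩ Set.Icc 0 (n : ℝ) ≠ ∅ := by
  simp only [vertexDegree, pos_iff_ne_zero, ne_eq, Set.encard_eq_zero, Set.iUnion_inter,
    Set.iUnion_eq_empty, not_forall]

/-- Exhausting the possible neighbours by finite ranges keeps the exponent a finite sum, so no
summability of the weights has to be known. -/
theorem measure_vertexDegree_pos (i n : ℕ) :
    P {ω | 0 < vertexDegree T n ω i} = ⨆ M : ℕ, ∫⁻ ω, ENNReal.ofReal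
      (1 - Real.exp (-(n * ∑ j ∈ Finset.range M, edgeRate (fun i => w i ω) i j))) ∂P := by
  have hU : {ω | 0 < vertexDegree T n ω i} =
      ⋃ M : ℕ, {ω | ∃ j ∈ Finset.range M, T i j ω ∩ Set.Icc 0 (n : ℝ) ≠ ∅} := by
    ext ω
    simp only [Set.mem_ofPred_eq, vertexDegree_pos_iff, Set.mem_iUnion, Finset.mem_range]
    exact ⟨fun ⟨j, hj⟩ => ⟨j + 1, j, j.lt_succ_self, hj⟩, fun ⟨_, j, _, hj⟩ => ⟨j, hj⟩⟩
  rw [hU, Monotone.measure_iUnion]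
  · simp_rw [hG.measure_exists_inter_Icc_ne_empty]
  · rintro a b hab ω ⟨j, hj, h⟩
    exact ⟨j, Finset.range_mono hab hj, h⟩

omit [IsProbabilityMeasure P] in
theorem lintegral_numVertices (n : ℕ) :
    ∫⁻ ω, numVertices T n ω ∂P = ∑' i, P {ω | 0 < vertexDegree T n ω i} := by
  classical
  have hmeas : ∀ i, MeasurableSet {ω | 0 < vertexDegree T n ω i} := by
    intro i
    simp_rw [vertexDegree_pos_iff, Set.ofPred_exists]
    exact .iUnion fun j => hG.measurableSet_inter_Icc_ne_empty i j n
  have : ∀ ω, numVertices T n ω =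
      ∑' i, {ω | 0 < vertexDegree T n ω i}.indicator (fun _ => (1 : ℝ≥0∞)) ω := by
    intro ω
    rw [numVertices, coe_encard_setOf]
    simp [Set.indicator_apply]
  simp_rw [this]
  rw [lintegral_tsum fun i => (measurable_const.indicator (hmeas i)).aemeasurable]
  congr 1 with i
  exact lintegral_indicator_one (hmeas i)

/-- In the factor 2 + m, one unit is the constant part of `one_sub_exp_neg_mul_le`, m comes from
pairs of points, and the other unit bounds the diagonal because weights are at most 1. -/
theorem lintegral_numVertices_le [SigmaFinite ν] (n : ℕ) :
    ∫⁻ ω, numVertices T n ω ∂P ≤ (2 + ∫⁻ v, ENNReal.ofReal (v : ℝ) ∂ν) *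
      ∫⁻ v, ENNReal.ofReal (1 - Real.exp (-(n * (v : ℝ)))) ∂ν := by
  have hf : Measurable fun v : unitInterval => ENNReal.ofReal (v : ℝ) := by fun_prop
  have hg : Measurable fun v : unitInterval => ENNReal.ofReal (1 - Real.exp (-(n * (v : ℝ)))) := by
    fun_prop
  have hfw := fun j => hf.comp (hG.weights.measurable j)
  have hgw := fun j => hg.comp (hG.weights.measurable j)
  set f : unitInterval → ℝ≥0∞ := fun v => ENNReal.ofReal (v : ℝ) with hfdef
  set g : unitInterval → ℝ≥0∞ := fun v => ENNReal.ofReal (1 - Real.exp (-(n * (v : ℝ)))) with hgdef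
  have hpt : ∀ i, P {ω | 0 < vertexDegree T n ω i} ≤
      ∫⁻ ω, (g (w i ω) + ∑' j, g (w i ω) * f (w j ω)) ∂P := by
    intro i
    rw [hG.measure_vertexDegree_pos]
    refine iSup_le fun M => lintegral_mono fun ω => ?_
    have hnn : ∀ j, 0 ≤ (w j ω : ℝ) := fun j => (w j ω).2.1
    have h1 : ((∑ j ∈ Finset.range M, edgeRate (fun i => w i ω) i j : ℝ≥0) : ℝ) ≤
        w i ω * ∑ j ∈ Finset.range M, (w j ω : ℝ) := by
      rw [NNReal.coe_sum, Finset.mul_sum]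
      refine Finset.sum_le_sum fun j _ => ?_
      have := edgeRate_le (fun i => w i ω) i j
      exact_mod_cast this
    have h2 : 1 - Real.exp (-(n * ∑ j ∈ Finset.range M, edgeRate (fun i => w i ω) i j : ℝ)) ≤
        (1 + ∑ j ∈ Finset.range M, (w j ω : ℝ)) * (1 - Real.exp (-(n * (w i ω : ℝ)))) := by
      refine le_trans ?_ (one_sub_exp_neg_mul_le (Finset.sum_nonneg fun j _ => hnn j)
        (mul_nonneg n.cast_nonneg (hnn i)))
      rw [mul_assoc]
      gcongr
    rw [ENNReal.tsum_mul_left]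
    calc ENNReal.ofReal _ ≤ _ := ENNReal.ofReal_le_ofReal h2
      _ = (1 + ∑ j ∈ Finset.range M, f (w j ω)) * g (w i ω) := by
        rw [ENNReal.ofReal_mul (add_nonneg zero_le_one (Finset.sum_nonneg fun j _ => hnn j)),
          ENNReal.ofReal_add zero_le_one (Finset.sum_nonneg fun j _ => hnn j), ENNReal.ofReal_one,
          ENNReal.ofReal_sum_of_nonneg fun j _ => hnn j]
      _ ≤ (1 + ∑' j, f (w j ω)) * g (w i ω) := by
        gcongr
        exact ENNReal.sum_le_tsum _
      _ = g (w i ω) + g (w i ω) * ∑' j, f (w j ω) := by ring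
  rw [hG.lintegral_numVertices]
  calc ∑' i, P {ω | 0 < vertexDegree T n ω i}
      ≤ ∑' i, ∫⁻ ω, (g (w i ω) + ∑' j, g (w i ω) * f (w j ω)) ∂P := ENNReal.tsum_le_tsum hpt
    _ = ∑' i, ∫⁻ ω, g (w i ω) ∂P + ∑' i, ∑' j, ∫⁻ ω, g (w i ω) * f (w j ω) ∂P := by
        rw [← ENNReal.tsum_add]
        congr 1 with i
        rw [lintegral_add_left (f := fun ω => g (w i ω)) (hgw i), lintegral_tsum (f := fun j ω =>
          g (w i ω) * f (w j ω)) fun j => ((hgw i).mul (hfw j)).aemeasurable]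
    _ = ∫⁻ v, g v ∂ν + ((∫⁻ v, g v ∂ν) * (∫⁻ v, f v ∂ν) + ∫⁻ v, g v * f v ∂ν) := by
        rw [hG.weights.lintegral_tsum_comp hg,
          hG.weights.lintegral_tsum_comp₂ (f := fun p => g p.1 * f p.2) (by fun_prop)]
        simp_rw [lintegral_const_mul _ hf, lintegral_mul_const _ hg]
    _ ≤ ∫⁻ v, g v ∂ν + ((∫⁻ v, g v ∂ν) * (∫⁻ v, f v ∂ν) + ∫⁻ v, g v ∂ν) := by
        exact add_le_add_right (add_le_add_right (lintegral_ofReal_mul_le ν g) _) _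
    _ = _ := by ring

theorem lintegral_numBinaryEdges_le [SigmaFinite ν] (n : ℕ) :
    ∫⁻ ω, numBinaryEdges T n ω ∂P ≤
      ∫⁻ u, ∫⁻ v, ENNReal.ofReal (1 - Real.exp (-(n * ((u : ℝ) * (v : ℝ))))) ∂ν ∂ν +
        ∫⁻ v, ENNReal.ofReal (1 - Real.exp (-(n * ((v : ℝ) * (v : ℝ))))) ∂ν := by
  classical
  have hms := fun i j => hG.measurableSet_inter_Icc_ne_empty i j n
  have hdeg : ∀ ω i, (binaryDegree T n ω i : ℝ≥0∞) =
      ∑' j, {ω | T i j ω ∩ Set.Icc 0 (n : ℝ) ≠ ∅}.indicator (fun _ => (1 : ℝ≥0∞)) ω := by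
    intro ω i
    rw [binaryDegree, coe_encard_setOf]
    simp [Set.indicator_apply, pos_iff_ne_zero]
  have hP : ∀ i j, P {ω | T i j ω ∩ Set.Icc 0 (n : ℝ) ≠ ∅} ≤
      ∫⁻ ω, ENNReal.ofReal (1 - Real.exp (-(n * ((w i ω : ℝ) * (w j ω : ℝ))))) ∂P := by
    intro i j
    have := hG.measure_exists_inter_Icc_ne_empty i n {j}
    simp only [Finset.mem_singleton, exists_eq_left, Finset.sum_singleton] at this
    rw [this]
    refine lintegral_mono fun ω => ?_
    have := edgeRate_le (fun i => w i ω) i j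
    have h1 : (edgeRate (fun i => w i ω) i j : ℝ) ≤ (w i ω : ℝ) * (w j ω : ℝ) := by
      exact_mod_cast this
    beta_reduce
    gcongr
  calc ∫⁻ ω, numBinaryEdges T n ω ∂P
      ≤ ∫⁻ ω, ∑' i, ∑' j,
          {ω | T i j ω ∩ Set.Icc 0 (n : ℝ) ≠ ∅}.indicator (fun _ => (1 : ℝ≥0∞)) ω ∂P := by
        refine lintegral_mono fun ω => ?_
        refine (mul_le_of_le_one_left' (by simp)).trans (ENNReal.tsum_le_tsum fun i => ?_)
        rw [hdeg]
    _ = ∑' i, ∑' j, P {ω | T i j ω ∩ Set.Icc 0 (n : ℝ) ≠ ∅} := by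
        rw [lintegral_tsum fun i => (Measurable.tsum fun j =>
          measurable_const.indicator (hms i j)).aemeasurable]
        congr 1 with i
        rw [lintegral_tsum fun j => (measurable_const.indicator (hms i j)).aemeasurable]
        congr 1 with j
        exact lintegral_indicator_one (hms i j)
    _ ≤ ∑' i, ∑' j,
          ∫⁻ ω, ENNReal.ofReal (1 - Real.exp (-(n * ((w i ω : ℝ) * (w j ω : ℝ))))) ∂P :=
        ENNReal.tsum_le_tsum fun i => ENNReal.tsum_le_tsum fun j => hP i j
    _ = _ := hG.weights.lintegral_tsum_comp₂
        (f := fun p => ENNReal.ofReal (1 - Real.exp (-(n * ((p.1 : ℝ) * (p.2 : ℝ)))))) (by fun_prop)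

/-- A point of weight at least a serves as a common neighbour: it meets a point of weight at least
1/n at total rate at least a by time n. Stopping the second range below a makes the two point counts
independent and the two vertices distinct. -/
theorem exists_mul_le_lintegral_numVertices [SigmaFinite ν] {a : ℝ} (ha : 0 < a)
    (hνa : ν {v | a ≤ (v : ℝ)} ≠ 0) (hνa' : ∀ x : ℝ, 0 < x → ν {v | x ≤ (v : ℝ)} ≠ ∞) :
    ∃ c : ℝ≥0∞, 0 < c ∧ ∀ n : ℕ, 0 < n →
      c * ν {v | (n : ℝ)⁻¹ ≤ (v : ℝ) ∧ (v : ℝ) < a} ≤ ∫⁻ ω, numVertices T n ω ∂P := by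
  set A : Set unitInterval := {v | a ≤ (v : ℝ)} with hA
  have hAm : MeasurableSet A := measurableSet_le measurable_const measurable_subtype_coe
  set X : Set unitInterval → Ω → ℕ∞ := fun A ω => {i | w i ω ∈ A}.encard with hX
  have hXm := fun {B : Set unitInterval} (hB : MeasurableSet B) => hG.weights.measurable_encard hB
  have hpos : 0 < P {ω | X A ω ≠ 0} := by
    rw [pos_iff_ne_zero]
    intro h0
    have h1 := hG.weights.lintegral_encard hAm (hνa' a ha)
    have h2 : ∀ᵐ ω ∂P, (X A ω : ℝ≥0∞) = 0 := by
      have : ∀ᵐ ω ∂P, X A ω = 0 := by rw [ae_iff]; exact h0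
      filter_upwards [this] with ω hω
      simp [hω]
    rw [lintegral_congr_ae h2, lintegral_zero] at h1
    exact hνa h1.symm
  refine ⟨ENNReal.ofReal (1 - Real.exp (-a)) * P {ω | X A ω ≠ 0},
    ENNReal.mul_pos (by simpa using ha) hpos.ne', fun n hn => ?_⟩
  set B : Set unitInterval := {v | (n : ℝ)⁻¹ ≤ (v : ℝ) ∧ (v : ℝ) < a} with hB
  have hBm : MeasurableSet B := (measurableSet_le measurable_const measurable_subtype_coe).inter
    (measurableSet_lt measurable_subtype_coe measurable_const)
  have hBfin : ν B ≠ ∞ := measure_ne_top_of_subset (fun v hv => hv.1)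
    (hνa' (n : ℝ)⁻¹ (by positivity))
  have hAB : Disjoint A B := Set.disjoint_left.2 fun v hv hv' => not_le.2 hv'.2 hv
  have hφ : Measurable fun k : ℕ∞ => if k ≠ 0 then (1 : ℝ≥0∞) else 0 := measurable_of_countable _
  have hκ : Measurable fun k : ℕ∞ => (k : ℝ≥0∞) := measurable_of_countable _
  have hXAs : MeasurableSet {ω | X A ω ≠ 0} := by
    have : {ω | X A ω ≠ 0} = {ω | (X A ω : ℝ≥0∞) = 0}ᶜ := by ext; simp
    rw [this]
    exact (hXm hAm (measurableSet_singleton 0)).compl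
  have hφm : Measurable fun ω => if X A ω ≠ 0 then (1 : ℝ≥0∞) else 0 :=
    Measurable.ite hXAs measurable_const measurable_const
  have hind := lintegral_mul_eq_lintegral_mul_lintegral_of_indepFun hφm (hXm hBm)
    ((hG.weights.indepFun_encard hAm hBm hAB).comp hφ hκ)
  have hφint : ∫⁻ ω, (if X A ω ≠ 0 then (1 : ℝ≥0∞) else 0) ∂P = P {ω | X A ω ≠ 0} := by
    rw [← lintegral_indicator_one hXAs]
    simp [Set.indicator_apply]
  rw [hφint, hG.weights.lintegral_encard hBm hBfin] at hind
  have hBi : ∀ i, Measurable fun ω => B.indicator (fun _ => (1 : ℝ≥0∞)) (w i ω) := fun i =>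
    (measurable_const.indicator hBm).comp (hG.weights.measurable i)
  calc ENNReal.ofReal (1 - Real.exp (-a)) * P {ω | X A ω ≠ 0} * ν B
      = ∫⁻ ω, ENNReal.ofReal (1 - Real.exp (-a)) * ((if X A ω ≠ 0 then (1 : ℝ≥0∞) else 0) *
          ∑' i, B.indicator (fun _ => (1 : ℝ≥0∞)) (w i ω)) ∂P := by
        rw [mul_assoc, ← hind, lintegral_const_mul' _ _ ENNReal.ofReal_ne_top]
        simp_rw [← encard_setOf_mem_eq_tsum]
        rfl
    _ = ∑' i, ∫⁻ ω, ENNReal.ofReal (1 - Real.exp (-a)) * ((if X A ω ≠ 0 then (1 : ℝ≥0∞) else 0) *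
          B.indicator (fun _ => (1 : ℝ≥0∞)) (w i ω)) ∂P := by
        simp_rw [← ENNReal.tsum_mul_left]
        rw [lintegral_tsum fun i => by fun_prop]
    _ ≤ ∫⁻ ω, numVertices T n ω ∂P := by
        rw [hG.lintegral_numVertices]
        refine ENNReal.tsum_le_tsum fun i => ?_
        rw [hG.measure_vertexDegree_pos, ← lintegral_iSup]
        · refine lintegral_mono fun ω => ?_
          by_cases h1 : X A ω ≠ 0
          swap
          · simp [h1]
          by_cases h2 : w i ω ∈ B
          swap
          · simp [h2]
          obtain ⟨j, hj⟩ := Set.encard_ne_zero.1 h1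
          have hj : a ≤ (w j ω : ℝ) := hj
          have hij : i ≠ j := by
            rintro rfl
            exact not_le.2 h2.2 hj
          simp only [h1, h2, Set.indicator_of_mem, if_true, mul_one, ne_eq, not_false_eq_true]
          -- `j + 1` is the first range containing the heavy vertex j, whose edge alone gives enough
          -- rate.
          refine le_iSup_of_le (j + 1) (ENNReal.ofReal_le_ofReal ?_)
          have h3 : (edgeRate (fun i => w i ω) i j : ℝ) ≤
              ((∑ j ∈ Finset.range (j + 1), edgeRate (fun i => w i ω) i j : ℝ≥0) : ℝ) :=
            NNReal.coe_le_coe.2 (Finset.single_le_sum (f := fun j => edgeRate (fun i => w i ω) i j)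
              (fun _ _ => zero_le) (Finset.self_mem_range_succ j))
          have h4 : (edgeRate (fun i => w i ω) i j : ℝ) = (w i ω : ℝ) * (w j ω : ℝ) := by
            simp [edgeRate, hij]
          have hn' : (0 : ℝ) < n := by exact_mod_cast hn
          have h5 : 1 ≤ (n : ℝ) * (w i ω : ℝ) := by
            have := mul_le_mul_of_nonneg_left h2.1 hn'.le
            rwa [mul_inv_cancel₀ hn'.ne'] at this
          have h6 : a ≤ n * ((∑ j ∈ Finset.range (j + 1),
              edgeRate (fun i => w i ω) i j : ℝ≥0) : ℝ) :=
            calc a ≤ (n * (w i ω : ℝ)) * (w j ω : ℝ) := by nlinarith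
              _ = n * (edgeRate (fun i => w i ω) i j : ℝ) := by rw [h4, mul_assoc]
              _ ≤ _ := by gcongr
          gcongr
        · intro M
          have : Measurable fun ω => ∑ j ∈ Finset.range M, edgeRate (fun i => w i ω) i j :=
            Finset.measurable_sum _ fun j _ => measurable_edgeRate hG.weights.measurable i j
          fun_prop
        · intro M M' hM ω
          beta_reduce
          gcongr

end IsPoissonizedGraph
end Expectations

/-! ### Regular variation: tail, truncated mean and ∫ (1 - e^{-nv}) dν -/

section RegularVariation

/-- The tail `ν [x, 1]` of a measure on the unit interval. -/
def upperTail (ν : Measure unitInterval) (x : ℝ) : ℝ≥0∞ := ν {v : unitInterval | x ≤ (v : ℝ)}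

/-- The truncated first moment of a measure on the unit interval. -/
noncomputable def lowerMean (ν : Measure unitInterval) (x : ℝ) : ℝ≥0∞ :=
  ∫⁻ v, {v : unitInterval | (v : ℝ) < x}.indicator (fun v => ENNReal.ofReal (v : ℝ)) v ∂ν

variable {ν : Measure unitInterval}

theorem upperTail_antitone (ν : Measure unitInterval) : Antitone (upperTail ν) :=
  fun _ _ hxy => measure_mono fun _ hv => hxy.trans hv

theorem measurableSet_setOf_le_coe (x : ℝ) : MeasurableSet {v : unitInterval | x ≤ (v : ℝ)} :=
  measurableSet_le measurable_const measurable_subtype_coe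

theorem measurableSet_setOf_coe_lt (x : ℝ) : MeasurableSet {v : unitInterval | (v : ℝ) < x} :=
  measurableSet_lt measurable_subtype_coe measurable_const

theorem measurable_indicator_ofReal_coe (x : ℝ) : Measurable fun v : unitInterval =>
    {v : unitInterval | (v : ℝ) < x}.indicator (fun v => ENNReal.ofReal (v : ℝ)) v :=
  Measurable.indicator (by fun_prop) (measurableSet_setOf_coe_lt x)

theorem mul_upperTail_le (x : ℝ) :
    ENNReal.ofReal x * upperTail ν x ≤ ∫⁻ v, ENNReal.ofReal (v : ℝ) ∂ν := by
  refine le_trans ?_ (mul_meas_ge_le_lintegral (by fun_prop) (ENNReal.ofReal x))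
  gcongr
  exact measure_mono fun v hv => ENNReal.ofReal_le_ofReal hv

theorem upperTail_ne_top (hν_mean : ∫⁻ v, ENNReal.ofReal (v : ℝ) ∂ν < ∞) {x : ℝ} (hx : 0 < x) :
    upperTail ν x ≠ ∞ := by
  have := ((mul_upperTail_le x).trans_lt hν_mean).ne
  intro h
  rw [h, ENNReal.mul_top (by simpa using hx)] at this
  exact this rfl

theorem tendsto_upperTail_inv [NullSingletonClass ν] (hν : ν Set.univ = ∞) :
    Tendsto (fun n : ℕ => upperTail ν (n : ℝ)⁻¹) atTop (𝓝 ∞) := by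
  -- At n = 0 the convention `0⁻¹ = 0` makes the set the whole interval, which would break
  -- monotonicity.
  rw [← tendsto_add_atTop_iff_nat 1]
  have hmono : Monotone fun n : ℕ => {v : unitInterval | (((n + 1 : ℕ) : ℝ))⁻¹ ≤ (v : ℝ)} := by
    intro a b hab v hv
    refine le_trans ?_ (show (((a + 1 : ℕ) : ℝ))⁻¹ ≤ (v : ℝ) from hv)
    gcongr
  have hU : ⋃ n : ℕ, {v : unitInterval | (((n + 1 : ℕ) : ℝ))⁻¹ ≤ (v : ℝ)} = {0}ᶜ := by
    ext v
    simp only [Set.mem_iUnion, Set.mem_ofPred_eq, Set.mem_compl_iff, Set.mem_singleton_iff]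
    constructor
    · rintro ⟨n, hn⟩ rfl
      have : (0 : ℝ) < (((n + 1 : ℕ) : ℝ))⁻¹ := by positivity
      exact absurd hn (by simpa using this)
    · intro hv
      have hpos : 0 < (v : ℝ) := lt_of_le_of_ne v.2.1 fun h => hv (Subtype.ext h.symm)
      obtain ⟨n, hn⟩ := exists_nat_one_div_lt hpos
      exact ⟨n, by push_cast; rw [← one_div]; exact hn.le⟩
  have h := tendsto_measure_iUnion_atTop (μ := ν) hmono
  rw [hU, measure_compl (measurableSet_singleton 0) (by simp), hν, measure_singleton,
    tsub_zero] at h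
  exact h

theorem HasRegularlyVaryingTail.tendsto_div {α : ℝ} {l : ℝ → ℝ}
    (h : HasRegularlyVaryingTail ν α l) :
    Tendsto (fun x : ℝ => (upperTail ν (x / 2)).toReal / (upperTail ν x).toReal) (𝓝[>] 0)
      (𝓝 (2 ^ α)) := by
  obtain ⟨hα0, hα1, hl, hE⟩ := h
  have hhalf : Tendsto (fun x : ℝ => x / 2) (𝓝[>] 0) (𝓝[>] 0) := by
    refine tendsto_nhdsWithin_iff.2 ⟨?_, ?_⟩
    · have : Tendsto (fun x : ℝ => x / 2) (𝓝 0) (𝓝 (0 / 2)) := tendsto_id.div_const 2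
      rw [zero_div] at this
      exact this.mono_left nhdsWithin_le_nhds
    · filter_upwards [self_mem_nhdsWithin] with x hx
      exact half_pos (show 0 < x from hx)
  have hdiv := (hE.comp_tendsto hhalf).div hE
  refine (IsEquivalent.tendsto_nhds_iff hdiv).2 ?_
  have hlim := ((hl.2 2 two_pos).comp tendsto_inv_nhdsGT_zero).const_mul ((2 : ℝ) ^ α)
  rw [mul_one] at hlim
  refine hlim.congr' ?_
  filter_upwards [self_mem_nhdsWithin] with x hx
  have hx : 0 < x := hx
  simp only [Function.comp_apply, Pi.div_apply]
  rw [Real.div_rpow hx.le two_pos.le, Real.rpow_neg two_pos.le, inv_div, div_eq_mul_inv 2 x]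
  have : x ^ (-α) ≠ 0 := (Real.rpow_pos_of_pos hx _).ne'
  field_simp

theorem HasRegularlyVaryingTail.exists_upperTail_half_le {α : ℝ} {l : ℝ → ℝ}
    (hν_mean : ∫⁻ v, ENNReal.ofReal (v : ℝ) ∂ν < ∞)
    (h : HasRegularlyVaryingTail ν α l) :
    ∃ c : ℝ≥0∞, c < 2 ∧ ∃ δ : ℝ, 0 < δ ∧ ∀ x, 0 < x → x < δ →
      upperTail ν (x / 2) ≤ c * upperTail ν x := by
  have h2 : (2 : ℝ) ^ α < 2 := by
    have := Real.rpow_lt_rpow_of_exponent_lt (x := 2) one_lt_two h.2.1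
    rwa [Real.rpow_one] at this
  obtain ⟨c, hc, hc2⟩ := exists_between h2
  have hc0 : 0 < c := lt_trans (by positivity) hc
  -- A nonzero ratio excludes a vanishing denominator, for which the bound on the quotient would say
  -- nothing.
  have hev := (h.tendsto_div.eventually_lt_const hc).and
    (h.tendsto_div.eventually_ne (Real.rpow_pos_of_pos two_pos α).ne')
  obtain ⟨δ, hδ, hsub⟩ := mem_nhdsGT_iff_exists_Ioo_subset.1 hev
  refine ⟨ENNReal.ofReal c, by simpa using hc2, δ, hδ, fun x hx0 hxδ => ?_⟩
  obtain ⟨h3, h4⟩ := hsub ⟨hx0, hxδ⟩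
  have h5 : (upperTail ν x).toReal ≠ 0 := fun h0 => h4 (by rw [h0, div_zero])
  have h6 := (div_lt_iff₀ (lt_of_le_of_ne ENNReal.toReal_nonneg h5.symm)).1 h3
  rw [← ENNReal.ofReal_toReal (upperTail_ne_top hν_mean (half_pos hx0)),
    ← ENNReal.ofReal_toReal (upperTail_ne_top hν_mean hx0), ← ENNReal.ofReal_mul hc0.le]
  exact ENNReal.ofReal_le_ofReal h6.le

/-- The single term with x/2^(k+1) < v ≤ x/2^k already dominates. -/
theorem indicator_ofReal_coe_le_tsum {x : ℝ} (hx : 0 < x) (v : unitInterval) :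
    {v : unitInterval | (v : ℝ) < x}.indicator (fun v => ENNReal.ofReal (v : ℝ)) v ≤
      ∑' k : ℕ, ENNReal.ofReal (x / 2 ^ k) *
        {v : unitInterval | x / 2 ^ (k + 1) ≤ (v : ℝ)}.indicator (fun _ => (1 : ℝ≥0∞)) v := by
  by_cases hv : (v : ℝ) < x
  swap
  · simp [hv]
  rcases eq_or_lt_of_le v.2.1 with h0 | h0
  · have : v = 0 := Subtype.ext h0.symm
    refine le_of_eq_of_le ?_ zero_le
    simp [this, Set.indicator_apply]
  have hy : 0 < (v : ℝ) / x := div_pos h0 hx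
  obtain ⟨k, hk1, hk2⟩ := exists_nat_pow_near_of_lt_one hy ((div_lt_one hx).2 hv).le
    (y := (1 / 2 : ℝ)) (by norm_num) (by norm_num)
  refine le_trans ?_ (ENNReal.le_tsum k)
  have hle : x / 2 ^ (k + 1) ≤ (v : ℝ) := by
    have := (lt_div_iff₀ hx).1 hk1
    rw [one_div, inv_pow] at this
    rw [div_eq_inv_mul]
    exact this.le
  have hle' : (v : ℝ) ≤ x / 2 ^ k := by
    have := (div_le_iff₀ hx).1 hk2
    rw [one_div, inv_pow] at this
    rwa [div_eq_inv_mul]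
  rw [Set.indicator_of_mem (show v ∈ {v : unitInterval | x / 2 ^ (k + 1) ≤ (v : ℝ)} from hle),
    mul_one]
  exact (Set.indicator_le_self _ _ _).trans (ENNReal.ofReal_le_ofReal hle')

/-- A Karamata-type bound. Iterated halving gives H(x/2^k) ≤ c^k H(x), so the dyadic blocks are
dominated by a geometric series of ratio c/2 < 1; the extra factor c comes from using the lower end
of each block. -/
theorem HasRegularlyVaryingTail.exists_lowerMean_le {α : ℝ} {l : ℝ → ℝ}
    (hν_mean : ∫⁻ v, ENNReal.ofReal (v : ℝ) ∂ν < ∞)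
    (h : HasRegularlyVaryingTail ν α l) :
    ∃ C : ℝ≥0∞, C ≠ ∞ ∧ ∃ δ : ℝ, 0 < δ ∧ ∀ x, 0 < x → x < δ →
      lowerMean ν x ≤ C * ENNReal.ofReal x * upperTail ν x := by
  obtain ⟨c, hc, δ, hδ, hhalf⟩ := h.exists_upperTail_half_le hν_mean
  have hc_top : c ≠ ∞ := (hc.trans ENNReal.ofNat_lt_top).ne
  have hc1 : 2⁻¹ * c < 1 := by
    rw [mul_comm, ← div_eq_mul_inv]
    exact ENNReal.div_lt_of_lt_mul (by simpa using hc)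
  refine ⟨c * (1 - 2⁻¹ * c)⁻¹, ENNReal.mul_ne_top hc_top
    (ENNReal.inv_ne_top.2 (tsub_pos_of_lt hc1).ne'), δ, hδ, fun x hx0 hxδ => ?_⟩
  have hpow : ∀ k : ℕ, upperTail ν (x / 2 ^ k) ≤ c ^ k * upperTail ν x := by
    intro k
    induction k with
    | zero => simp
    | succ k ih =>
      have h1 : x / 2 ^ k < δ :=
        (div_le_self hx0.le (one_le_pow₀ one_le_two)).trans_lt hxδ
      calc upperTail ν (x / 2 ^ (k + 1)) = upperTail ν (x / 2 ^ k / 2) := by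
            rw [pow_succ, div_div]
        _ ≤ c * upperTail ν (x / 2 ^ k) := hhalf _ (by positivity) h1
        _ ≤ c * (c ^ k * upperTail ν x) := by gcongr
        _ = c ^ (k + 1) * upperTail ν x := by ring
  calc lowerMean ν x
      ≤ ∫⁻ v, ∑' k : ℕ, ENNReal.ofReal (x / 2 ^ k) *
        {v : unitInterval | x / 2 ^ (k + 1) ≤ (v : ℝ)}.indicator (fun _ => (1 : ℝ≥0∞)) v ∂ν :=
        lintegral_mono fun v => indicator_ofReal_coe_le_tsum hx0 v
    _ = ∑' k : ℕ, ENNReal.ofReal (x / 2 ^ k) * upperTail ν (x / 2 ^ (k + 1)) := by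
        rw [lintegral_tsum fun k => ((measurable_const.indicator
          (measurableSet_setOf_le_coe _)).const_mul _).aemeasurable]
        congr 1 with k
        rw [lintegral_const_mul' _ _ ENNReal.ofReal_ne_top]
        congr 1
        exact lintegral_indicator_one (measurableSet_setOf_le_coe _)
    _ ≤ ∑' k : ℕ, (ENNReal.ofReal x * c * upperTail ν x) * (2⁻¹ * c) ^ k := by
        refine ENNReal.tsum_le_tsum fun k => ?_
        have h2 : ENNReal.ofReal (x / 2 ^ k) = ENNReal.ofReal x * 2⁻¹ ^ k := by
          rw [div_eq_mul_inv, ENNReal.ofReal_mul hx0.le, ← inv_pow,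
            ENNReal.ofReal_pow (by norm_num), ENNReal.ofReal_inv_of_pos two_pos,
            ENNReal.ofReal_ofNat]
        rw [h2]
        calc ENNReal.ofReal x * 2⁻¹ ^ k * upperTail ν (x / 2 ^ (k + 1))
            ≤ ENNReal.ofReal x * 2⁻¹ ^ k * (c ^ (k + 1) * upperTail ν x) := by
              gcongr
              exact hpow _
          _ = _ := by rw [mul_pow, pow_succ]; ring
    _ = c * (1 - 2⁻¹ * c)⁻¹ * ENNReal.ofReal x * upperTail ν x := by
        rw [ENNReal.tsum_mul_left, ENNReal.tsum_geometric]
        ring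

theorem ofReal_one_sub_exp_neg_le (n : ℕ) {y : ℝ} :
    ENNReal.ofReal (1 - Real.exp (-(n * y))) ≤ n * ENNReal.ofReal y := by
  rw [← ENNReal.ofReal_natCast, ← ENNReal.ofReal_mul n.cast_nonneg]
  exact ENNReal.ofReal_le_ofReal (by linarith [Real.add_one_le_exp (-(n * y))])

theorem ofReal_one_sub_exp_neg_le_one (y : ℝ) : ENNReal.ofReal (1 - Real.exp (-y)) ≤ 1 :=
  ENNReal.ofReal_le_one.2 (by linarith [Real.exp_pos (-y)])

theorem lintegral_one_sub_exp_le (n : ℕ) (x : ℝ) :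
    ∫⁻ v, ENNReal.ofReal (1 - Real.exp (-(n * (v : ℝ)))) ∂ν ≤
      n * lowerMean ν x + upperTail ν x := by
  have h1 : upperTail ν x =
      ∫⁻ v, {v : unitInterval | x ≤ (v : ℝ)}.indicator (fun _ => (1 : ℝ≥0∞)) v ∂ν :=
    (lintegral_indicator_one (measurableSet_setOf_le_coe x)).symm
  rw [lowerMean, h1, ← lintegral_const_mul' _ _ (by simp),
    ← lintegral_add_left ((measurable_indicator_ofReal_coe x).const_mul _)]
  refine lintegral_mono fun v => ?_
  rcases lt_or_ge (v : ℝ) x with hv | hv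
  · simpa [hv] using ofReal_one_sub_exp_neg_le n
  · simpa [hv] using ofReal_one_sub_exp_neg_le_one _

/-- Cut at x = 1/n, where n x = 1 and both parts are of order H(1/n). -/
theorem HasRegularlyVaryingTail.exists_lintegral_one_sub_exp_le {α : ℝ} {l : ℝ → ℝ}
    (hν_mean : ∫⁻ v, ENNReal.ofReal (v : ℝ) ∂ν < ∞)
    (h : HasRegularlyVaryingTail ν α l) :
    ∃ C : ℝ≥0∞, C ≠ ∞ ∧ ∀ᶠ n : ℕ in atTop,
      ∫⁻ v, ENNReal.ofReal (1 - Real.exp (-(n * (v : ℝ)))) ∂ν ≤ C * upperTail ν (n : ℝ)⁻¹ := by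
  obtain ⟨C, hC, δ, hδ, hle⟩ := h.exists_lowerMean_le hν_mean
  refine ⟨C + 1, by finiteness, ?_⟩
  filter_upwards [tendsto_inv_atTop_nhds_zero_nat.eventually_lt_const hδ,
    eventually_gt_atTop 0] with n hn hn0
  have hn0' : (0 : ℝ) < n := by exact_mod_cast hn0
  have hmul : (n : ℝ≥0∞) * ENNReal.ofReal (n : ℝ)⁻¹ = 1 := by
    rw [← ENNReal.ofReal_natCast, ← ENNReal.ofReal_mul hn0'.le, mul_inv_cancel₀ hn0'.ne',
      ENNReal.ofReal_one]
  calc ∫⁻ v, ENNReal.ofReal (1 - Real.exp (-(n * (v : ℝ)))) ∂ν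
      ≤ n * lowerMean ν (n : ℝ)⁻¹ + upperTail ν (n : ℝ)⁻¹ := lintegral_one_sub_exp_le n _
    _ ≤ n * (C * ENNReal.ofReal (n : ℝ)⁻¹ * upperTail ν (n : ℝ)⁻¹) + upperTail ν (n : ℝ)⁻¹ := by
        gcongr
        exact hle _ (by positivity) hn
    _ = C * (n * ENNReal.ofReal (n : ℝ)⁻¹) * upperTail ν (n : ℝ)⁻¹ + upperTail ν (n : ℝ)⁻¹ := by
        ring
    _ = (C + 1) * upperTail ν (n : ℝ)⁻¹ := by rw [hmul]; ring

end RegularVariation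

/-! ### The integral over pairs that controls binary edges -/

section PairIntegrals

variable {ν : Measure unitInterval}

/-- The integral of `1 - exp (-n u v)` against `ν ⊗ ν` plus the image of `ν` on the diagonal. -/
noncomputable def pairIntegral (ν : Measure unitInterval) (n : ℕ) : ℝ≥0∞ :=
  ∫⁻ u, ∫⁻ v, ENNReal.ofReal (1 - Real.exp (-(n * ((u : ℝ) * (v : ℝ))))) ∂ν ∂ν +
    ∫⁻ v, ENNReal.ofReal (1 - Real.exp (-(n * ((v : ℝ) * (v : ℝ))))) ∂ν

theorem lintegral_lintegral_sum_mul {S : Type*} [MeasurableSpace S] {ν : Measure S}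
    {a b c a' b' c' : S → ℝ≥0∞}
    (ha : Measurable a) (hb : Measurable b) (hc : Measurable c)
    (ha' : Measurable a') (hb' : Measurable b') (hc' : Measurable c') :
    ∫⁻ u, ∫⁻ v, (a u * a' v + b u * b' v + c u * c' v) ∂ν ∂ν =
      (∫⁻ u, a u ∂ν) * (∫⁻ v, a' v ∂ν) + (∫⁻ u, b u ∂ν) * (∫⁻ v, b' v ∂ν) +
        (∫⁻ u, c u ∂ν) * (∫⁻ v, c' v ∂ν) := by
  have h1 : ∀ u, ∫⁻ v, (a u * a' v + b u * b' v + c u * c' v) ∂ν =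
      a u * (∫⁻ v, a' v ∂ν) + b u * (∫⁻ v, b' v ∂ν) + c u * (∫⁻ v, c' v ∂ν) := by
    intro u
    rw [lintegral_add_left (by fun_prop), lintegral_add_left (by fun_prop),
      lintegral_const_mul _ ha', lintegral_const_mul _ hb', lintegral_const_mul _ hc']
  simp_rw [h1]
  rw [lintegral_add_left (by fun_prop), lintegral_add_left (by fun_prop),
    lintegral_mul_const _ ha, lintegral_mul_const _ hb, lintegral_mul_const _ hc]

theorem ofReal_one_sub_exp_neg_mul_le (n : ℕ) (u v : unitInterval) :
    ENNReal.ofReal (1 - Real.exp (-(n * ((u : ℝ) * (v : ℝ))))) ≤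
      n * (ENNReal.ofReal (u : ℝ) * ENNReal.ofReal (v : ℝ)) := by
  rw [← ENNReal.ofReal_mul u.2.1]
  exact ofReal_one_sub_exp_neg_le n

theorem ofReal_one_sub_exp_neg_mul_le_right (n : ℕ) (u v : unitInterval) :
    ENNReal.ofReal (1 - Real.exp (-(n * ((u : ℝ) * (v : ℝ))))) ≤
      ENNReal.ofReal (1 - Real.exp (-(n * (v : ℝ)))) := by
  have : (u : ℝ) * v ≤ v := mul_le_of_le_one_left v.2.1 u.2.2
  gcongr

theorem upperTail_eq_lintegral (x : ℝ) : upperTail ν x =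
    ∫⁻ v, {v : unitInterval | x ≤ (v : ℝ)}.indicator (fun _ => (1 : ℝ≥0∞)) v ∂ν :=
  (lintegral_indicator_one (measurableSet_setOf_le_coe x)).symm

theorem lintegral_indicator_mul_le (x : ℝ) :
    ∫⁻ v, {v : unitInterval | (v : ℝ) < x}.indicator (fun v => ENNReal.ofReal (v : ℝ)) v *
      ENNReal.ofReal (v : ℝ) ∂ν ≤ ENNReal.ofReal x * lowerMean ν x := by
  rw [lowerMean, ← lintegral_const_mul' _ _ ENNReal.ofReal_ne_top]
  refine lintegral_mono fun v => ?_
  rcases lt_or_ge (v : ℝ) x with hv | hv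
  · simp only [Set.indicator_of_mem (show v ∈ {v : unitInterval | (v : ℝ) < x} from hv)]
    gcongr
  · simp [hv]

/-- The integrand is at most 1 when both weights are at least x. Otherwise it is at most nuv with
one weight below x and the other unrestricted, which yields F(x) times the mean. -/
theorem pairIntegral_le_of_mean [SigmaFinite ν] (n : ℕ) (x : ℝ) :
    pairIntegral ν n ≤ upperTail ν x * upperTail ν x +
      2 * (n * (lowerMean ν x * ∫⁻ v, ENNReal.ofReal (v : ℝ) ∂ν)) +
      (upperTail ν x + 2 * (n * (ENNReal.ofReal x * lowerMean ν x))) := by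
  have hI : Measurable fun v : unitInterval =>
      {v : unitInterval | x ≤ (v : ℝ)}.indicator (fun _ => (1 : ℝ≥0∞)) v :=
    measurable_const.indicator (measurableSet_setOf_le_coe x)
  have hL := measurable_indicator_ofReal_coe x
  have hf : Measurable fun v : unitInterval => ENNReal.ofReal (v : ℝ) := by fun_prop
  have hU := upperTail_eq_lintegral (ν := ν) x
  have hLint : lowerMean ν x = ∫⁻ v, {v : unitInterval | (v : ℝ) < x}.indicator
    (fun v => ENNReal.ofReal (v : ℝ)) v ∂ν := rfl
  have hdiag := lintegral_indicator_mul_le (ν := ν) x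
  set I := fun v : unitInterval =>
      {v : unitInterval | x ≤ (v : ℝ)}.indicator (fun _ => (1 : ℝ≥0∞)) v with hIdef
  set L := fun v : unitInterval =>
    {v : unitInterval | (v : ℝ) < x}.indicator (fun v => ENNReal.ofReal (v : ℝ)) v with hLdef
  set f := fun v : unitInterval => ENNReal.ofReal (v : ℝ) with hfdef
  have hpt : ∀ u v : unitInterval, ENNReal.ofReal (1 - Real.exp (-(n * ((u : ℝ) * (v : ℝ))))) ≤
      I u * I v + n * L u * f v + n * f u * L v := by
    intro u v
    have h1 := ofReal_one_sub_exp_neg_mul_le n u v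
    have h2 := ofReal_one_sub_exp_neg_le_one (n * ((u : ℝ) * (v : ℝ)))
    rcases lt_or_ge (u : ℝ) x with hu | hu
    · refine le_add_right (le_add_left ?_)
      rw [hLdef, mul_assoc]
      simpa [hu] using h1
    rcases lt_or_ge (v : ℝ) x with hv | hv
    · refine le_add_left ?_
      rw [hLdef, mul_assoc]
      simpa [hv] using h1
    · refine le_add_right (le_add_right ?_)
      simpa [hIdef, hu, hv] using h2
  rw [pairIntegral]
  refine add_le_add ?_ ?_
  · calc _ ≤ ∫⁻ u, ∫⁻ v, (I u * I v + n * L u * f v + n * f u * L v) ∂ν ∂ν :=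
          lintegral_mono fun u => lintegral_mono fun v => hpt u v
      _ = _ := by
          rw [lintegral_lintegral_sum_mul hI (hL.const_mul _) (hf.const_mul _) hI hf hL,
            lintegral_const_mul _ hL, lintegral_const_mul _ hf, ← hU, ← hLint]
          ring
  · calc _ ≤ ∫⁻ v, (I v + 2 * (n * (L v * f v))) ∂ν := by
          refine lintegral_mono fun v => (hpt v v).trans ?_
          have : I v * I v = I v := by
            simp only [hIdef, Set.indicator_apply]
            split_ifs <;> simp
          rw [this]
          apply le_of_eq
          ring
      _ = upperTail ν x + 2 * (n * ∫⁻ v, L v * f v ∂ν) := by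
          rw [lintegral_add_left hI, lintegral_const_mul _ (by fun_prop),
            lintegral_const_mul _ (by fun_prop), ← hU]
      _ ≤ _ := by
          exact add_le_add_right (mul_le_mul_right (mul_le_mul_right hdiag _) _) _

/-- If one weight is at least x, replace it by 1 in the exponent, which decouples the variables; if
both are below x, use nuv. -/
theorem pairIntegral_le_of_tail [SigmaFinite ν] (n : ℕ) (x : ℝ) :
    pairIntegral ν n ≤ 2 * (upperTail ν x *
      ∫⁻ v, ENNReal.ofReal (1 - Real.exp (-(n * (v : ℝ)))) ∂ν) +
      n * (lowerMean ν x * lowerMean ν x) +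
      (2 * upperTail ν x + n * (ENNReal.ofReal x * lowerMean ν x)) := by
  have hI : Measurable fun v : unitInterval =>
      {v : unitInterval | x ≤ (v : ℝ)}.indicator (fun _ => (1 : ℝ≥0∞)) v :=
    measurable_const.indicator (measurableSet_setOf_le_coe x)
  have hL := measurable_indicator_ofReal_coe x
  have hg : Measurable fun v : unitInterval => ENNReal.ofReal (1 - Real.exp (-(n * (v : ℝ)))) := by
    fun_prop
  have hg1 : ∀ v : unitInterval, ENNReal.ofReal (1 - Real.exp (-(n * (v : ℝ)))) ≤ 1 := fun v =>
    ofReal_one_sub_exp_neg_le_one _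
  have hU := upperTail_eq_lintegral (ν := ν) x
  have hLint : lowerMean ν x = ∫⁻ v, {v : unitInterval | (v : ℝ) < x}.indicator
    (fun v => ENNReal.ofReal (v : ℝ)) v ∂ν := rfl
  have hdiag := lintegral_indicator_mul_le (ν := ν) x
  have hpt0 := ofReal_one_sub_exp_neg_mul_le_right n
  set I := fun v : unitInterval =>
      {v : unitInterval | x ≤ (v : ℝ)}.indicator (fun _ => (1 : ℝ≥0∞)) v with hIdef
  set L := fun v : unitInterval =>
    {v : unitInterval | (v : ℝ) < x}.indicator (fun v => ENNReal.ofReal (v : ℝ)) v with hLdef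
  have hLf : ∀ v, L v ≤ ENNReal.ofReal (v : ℝ) := fun v => Set.indicator_le_self _ _ _
  set g := fun v : unitInterval => ENNReal.ofReal (1 - Real.exp (-(n * (v : ℝ)))) with hgdef
  have hpt : ∀ u v : unitInterval, ENNReal.ofReal (1 - Real.exp (-(n * ((u : ℝ) * (v : ℝ))))) ≤
      I u * g v + g u * I v + n * L u * L v := by
    intro u v
    rcases lt_or_ge (u : ℝ) x with hu | hu
    swap
    · refine le_add_right (le_add_right ?_)
      simpa [hIdef, hu] using hpt0 u v
    rcases lt_or_ge (v : ℝ) x with hv | hv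
    · refine le_add_left ?_
      rw [hLdef, mul_assoc]
      simpa [hu, hv] using ofReal_one_sub_exp_neg_mul_le n u v
    · refine le_add_right (le_add_left ?_)
      have := hpt0 v u
      rw [mul_comm (v : ℝ)] at this
      simpa [hIdef, hv] using this
  rw [pairIntegral]
  refine add_le_add ?_ ?_
  · calc _ ≤ ∫⁻ u, ∫⁻ v, (I u * g v + g u * I v + n * L u * L v) ∂ν ∂ν :=
          lintegral_mono fun u => lintegral_mono fun v => hpt u v
      _ = _ := by
          rw [lintegral_lintegral_sum_mul hI hg (hL.const_mul _) hg hI hL,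
            lintegral_const_mul _ hL, ← hU, ← hLint]
          ring
  · calc _ ≤ ∫⁻ v, (2 * I v + n * (L v * ENNReal.ofReal (v : ℝ))) ∂ν := by
          refine lintegral_mono fun v => (hpt v v).trans ?_
          calc I v * g v + g v * I v + n * L v * L v
              ≤ I v * 1 + 1 * I v + n * L v * ENNReal.ofReal (v : ℝ) := by
                gcongr
                · exact hg1 v
                · exact hg1 v
                · exact hLf v
            _ = _ := by ring
      _ = 2 * upperTail ν x + n * ∫⁻ v, L v * ENNReal.ofReal (v : ℝ) ∂ν := by
          rw [lintegral_add_left (by fun_prop), lintegral_const_mul _ hI,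
            lintegral_const_mul _ (by fun_prop), ← hU]
      _ ≤ _ := by
          exact add_le_add_right (mul_le_mul_right hdiag _) _

theorem HasRegularlyVaryingTail.exists_pairIntegral_le [SigmaFinite ν] [NullSingletonClass ν]
    {α : ℝ} {l : ℝ → ℝ} (hν_infinite : ν Set.univ = ∞)
    (hν_mean : ∫⁻ v, ENNReal.ofReal (v : ℝ) ∂ν < ∞)
    (h : HasRegularlyVaryingTail ν α l) :
    ∃ K : ℝ≥0∞, K ≠ ∞ ∧ ∀ᶠ n : ℕ in atTop, pairIntegral ν n ≤
      K * (upperTail ν (√(n : ℝ))⁻¹ * min (ENNReal.ofReal √(n : ℝ)) (upperTail ν (n : ℝ)⁻¹)) := by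
  obtain ⟨C, hC, δ, hδ, hle⟩ := h.exists_lowerMean_le hν_mean
  obtain ⟨C', hC', hG⟩ := h.exists_lintegral_one_sub_exp_le hν_mean
  set m := ∫⁻ v, ENNReal.ofReal (v : ℝ) ∂ν with hm
  have hm_top : m ≠ ∞ := hν_mean.ne
  -- The two summands are the constants of the bounds by H·√n and by H·H₁ proved below.
  refine ⟨(m + 2 * (C * m) + 1 + 2 * C) + (2 * C' + C * C + 2 + C), by finiteness, ?_⟩
  have hsqrt : Tendsto (fun n : ℕ => (√(n : ℝ))⁻¹) atTop (𝓝 0) :=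
    tendsto_inv_atTop_zero.comp (Real.tendsto_sqrt_atTop.comp tendsto_natCast_atTop_atTop)
  filter_upwards [hsqrt.eventually_lt_const hδ, eventually_ge_atTop 1, hG,
    (tendsto_upperTail_inv hν_infinite).eventually_const_lt ENNReal.one_lt_top]
    with n hnδ hn1 hGn hH1
  have hn : (1 : ℝ) ≤ n := by exact_mod_cast hn1
  have hs1 : 1 ≤ √(n : ℝ) := Real.one_le_sqrt.2 hn
  have hs0 : 0 < √(n : ℝ) := by linarith
  have hF := hle _ (inv_pos.2 hs0) hnδ
  have hmono : upperTail ν (√(n : ℝ))⁻¹ ≤ upperTail ν (n : ℝ)⁻¹ := by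
    apply upperTail_antitone
    gcongr
    exact Real.sqrt_le_self_iff.2 (Or.inr hn)
  have hmarkov := mul_upperTail_le (ν := ν) (√(n : ℝ))⁻¹
  have hb1 := pairIntegral_le_of_mean (ν := ν) n (√(n : ℝ))⁻¹
  have hb2 := pairIntegral_le_of_tail (ν := ν) n (√(n : ℝ))⁻¹
  have hse : ENNReal.ofReal √(n : ℝ) * ENNReal.ofReal (√(n : ℝ))⁻¹ = 1 := by
    rw [← ENNReal.ofReal_mul hs0.le, mul_inv_cancel₀ hs0.ne', ENNReal.ofReal_one]
  have hss : (n : ℝ≥0∞) = ENNReal.ofReal √(n : ℝ) * ENNReal.ofReal √(n : ℝ) := by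
    rw [← ENNReal.ofReal_mul hs0.le, Real.mul_self_sqrt (by linarith), ENNReal.ofReal_natCast]
  have hs1' : 1 ≤ ENNReal.ofReal √(n : ℝ) := by simpa using hs1
  rw [← hm] at hmarkov hb1
  set H := upperTail ν (√(n : ℝ))⁻¹
  set H₁ := upperTail ν (n : ℝ)⁻¹
  set F := lowerMean ν (√(n : ℝ))⁻¹
  set s := ENNReal.ofReal √(n : ℝ)
  set ε := ENNReal.ofReal (√(n : ℝ))⁻¹
  rw [hss] at hb1 hb2
  -- At the cutoff ε = 1/s with s = √n, the truncated mean estimate becomes this bound, and Markov's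
  -- inequality gives the next one. The diagonal terms are absorbed using s ≥ 1 and H₁ > 1, the
  -- latter because ν is infinite.
  have hsF : s * F ≤ C * H :=
    calc s * F ≤ s * (C * ε * H) := by gcongr
      _ = (s * ε) * (C * H) := by ring
      _ = C * H := by rw [hse, one_mul]
  have hHs : H ≤ m * s :=
    calc H = (s * ε) * H := by rw [hse, one_mul]
      _ = ε * H * s := by ring
      _ ≤ m * s := by gcongr
  have hsse : s * s * (ε * F) ≤ C * H :=
    calc s * s * (ε * F) = (s * ε) * (s * F) := by ring
      _ ≤ 1 * (C * H) := by rw [hse]; gcongr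
      _ = C * H := one_mul _
  have hHs1 : H ≤ H * s := le_mul_of_one_le_right' hs1'
  have hHH1 : H ≤ H * H₁ := le_mul_of_one_le_right' hH1.le
  have hsse_s : s * s * (ε * F) ≤ C * (H * s) := hsse.trans (by gcongr)
  have hsse_H : s * s * (ε * F) ≤ C * (H * H₁) := hsse.trans (by gcongr)
  have hsF_H : s * F ≤ C * H₁ := hsF.trans (by gcongr)
  have h1 : pairIntegral ν n ≤ (m + 2 * (C * m) + 1 + 2 * C) * (H * s) :=
    calc pairIntegral ν n ≤ H * H + 2 * (s * s * (F * m)) + (H + 2 * (s * s * (ε * F))) := hb1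
      _ = H * H + 2 * (s * (s * F) * m) + (H + 2 * (s * s * (ε * F))) := by ring
      _ ≤ H * (m * s) + 2 * (s * (C * H) * m) + (H * s + 2 * (C * (H * s))) := by
          gcongr
      _ = _ := by ring
  have h2 : pairIntegral ν n ≤ (2 * C' + C * C + 2 + C) * (H * H₁) :=
    calc pairIntegral ν n ≤ 2 * (H * (C' * H₁)) + s * s * (F * F) +
          (2 * H + s * s * (ε * F)) := hb2.trans (by gcongr)
      _ = 2 * (H * (C' * H₁)) + (s * F) * (s * F) + (2 * H + s * s * (ε * F)) := by ring
      _ ≤ 2 * (H * (C' * H₁)) + (C * H) * (C * H₁) + (2 * (H * H₁) + C * (H * H₁)) := by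
          gcongr
      _ = _ := by ring
  rcases le_total s H₁ with hsH | hsH
  · rw [min_eq_left hsH]
    exact h1.trans (mul_le_mul_left le_self_add _)
  · rw [min_eq_right hsH]
    exact h2.trans (mul_le_mul_left le_add_self _)

end PairIntegrals

/-! ### From extended nonnegative bounds to the asymptotic statements -/

theorem isBigO_toReal_of_eventually_le {ι : Type*} {F : Filter ι} {a b : ι → ℝ≥0∞} {K : ℝ≥0∞}
    (hK : K ≠ ∞) (hb : ∀ᶠ n in F, b n ≠ ∞) (h : ∀ᶠ n in F, a n ≤ K * b n) :
    (fun n => (a n).toReal) =O[F] fun n => (b n).toReal := by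
  refine IsBigO.of_bound K.toReal ?_
  filter_upwards [hb, h] with n hn hle
  rw [Real.norm_of_nonneg ENNReal.toReal_nonneg, Real.norm_of_nonneg ENNReal.toReal_nonneg,
    ← ENNReal.toReal_mul]
  exact ENNReal.toReal_mono (ENNReal.mul_ne_top hK hn) hle

theorem HasRegularlyVaryingTail.isEquivalent_comp {ν : Measure unitInterval} {α : ℝ} {l : ℝ → ℝ}
    (h : HasRegularlyVaryingTail ν α l) {u : ℕ → ℝ} (hu : Tendsto u atTop atTop) :
    (fun n => (upperTail ν (u n)⁻¹).toReal) ~[atTop] fun n => u n ^ α * l (u n) := by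
  have h1 := h.2.2.2.comp_tendsto (tendsto_inv_atTop_nhdsGT_zero.comp hu)
  refine h1.congr_right ?_
  filter_upwards [hu.eventually_gt_atTop 0] with n hn
  simp [Real.inv_rpow hn.le, Real.rpow_neg hn.le]

theorem lemma5 {Ω : Type*} [MeasurableSpace Ω] (P : Measure Ω) [IsProbabilityMeasure P]
    (ν : Measure unitInterval) [SigmaFinite ν] [NullSingletonClass ν]
    (hν_infinite : ν Set.univ = ∞)
    (hν_mean : ∫⁻ v, ENNReal.ofReal (v : ℝ) ∂ν < ∞)
    (w : ℕ → Ω → unitInterval) (T : ℕ → ℕ → Ω → Set ℝ)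
    (hG : IsPoissonizedGraph ν P w T)
    (α : ℝ) (l : ℝ → ℝ) (htail : HasRegularlyVaryingTail ν α l) :
    (∀ n : ℕ, ∫⁻ ω, numVertices T n ω ∂P < ∞ ∧ ∫⁻ ω, numEdges T n ω ∂P < ∞ ∧
      ∫⁻ ω, numBinaryEdges T n ω ∂P < ∞) ∧
    (fun n : ℕ => (∫⁻ ω, numVertices T n ω ∂P).toReal) =Θ[atTop]
      (fun n : ℕ => (n : ℝ) ^ α * l n) ∧
    (fun n : ℕ => (∫⁻ ω, numEdges T n ω ∂P).toReal) =Θ[atTop] (fun n : ℕ => (n : ℝ)) ∧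
    (fun n : ℕ => (∫⁻ ω, numBinaryEdges T n ω ∂P).toReal) =O[atTop]
      (fun n : ℕ => l (√(n : ℝ)) *
        min ((n : ℝ) ^ ((1 + α) / 2)) (l n * (n : ℝ) ^ (3 * α / 2))) := by
  have hm : Measurable fun v : unitInterval => ENNReal.ofReal (v : ℝ) := by fun_prop
  have hm_top : ∫⁻ v, ENNReal.ofReal (v : ℝ) ∂ν ≠ ∞ := hν_mean.ne
  have hν : ν ≠ 0 := by
    rintro rfl
    simp at hν_infinite
  have hVfin : ∀ n : ℕ, ∫⁻ ω, numVertices T n ω ∂P < ∞ := by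
    intro n
    refine (hG.lintegral_numVertices_le n).trans_lt (ENNReal.mul_lt_top (by finiteness) ?_)
    calc ∫⁻ v, ENNReal.ofReal (1 - Real.exp (-(n * (v : ℝ)))) ∂ν
        ≤ ∫⁻ v, n * ENNReal.ofReal (v : ℝ) ∂ν :=
          lintegral_mono fun v => ofReal_one_sub_exp_neg_le n
      _ = n * ∫⁻ v, ENNReal.ofReal (v : ℝ) ∂ν := lintegral_const_mul _ hm
      _ < ∞ := by finiteness
  have hEfin : ∀ n : ℕ, ∫⁻ ω, numEdges T n ω ∂P < ∞ := fun n =>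
    (hG.lintegral_numEdges_le n).trans_lt (by finiteness)
  have hBle : ∀ n : ℕ, ∫⁻ ω, numBinaryEdges T n ω ∂P ≤ pairIntegral ν n :=
    hG.lintegral_numBinaryEdges_le
  have hBfin : ∀ n : ℕ, ∫⁻ ω, numBinaryEdges T n ω ∂P < ∞ := by
    intro n
    -- Any positive cutoff would do: only finiteness is needed here.
    refine ((hBle n).trans (pairIntegral_le_of_mean n 2)).trans_lt ?_
    have h1 : upperTail ν 2 ≠ ∞ := upperTail_ne_top hν_mean two_pos
    have h2 : lowerMean ν 2 ≠ ∞ := by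
      refine ne_top_of_le_ne_top hm_top (lintegral_mono fun v => ?_)
      exact Set.indicator_le_self _ _ _
    finiteness
  have htop : ∀ x : ℝ, 0 < x → upperTail ν x ≠ ∞ := fun x hx => upperTail_ne_top hν_mean hx
  have hevtop : ∀ᶠ n : ℕ in atTop, upperTail ν (n : ℝ)⁻¹ ≠ ∞ := by
    filter_upwards [eventually_gt_atTop 0] with n hn
    exact htop _ (by positivity)
  have hH : (fun n : ℕ => (upperTail ν (n : ℝ)⁻¹).toReal) ~[atTop]
      fun n : ℕ => (n : ℝ) ^ α * l n := htail.isEquivalent_comp tendsto_natCast_atTop_atTop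
  have hsqrt : Tendsto (fun n : ℕ => √(n : ℝ)) atTop atTop :=
    Real.tendsto_sqrt_atTop.comp tendsto_natCast_atTop_atTop
  have hHs := htail.isEquivalent_comp hsqrt
  have htend := tendsto_upperTail_inv hν_infinite
  refine ⟨fun n => ⟨hVfin n, hEfin n, hBfin n⟩, ?_, ?_, ?_⟩
  · refine IsTheta.trans ⟨?_, ?_⟩ hH.isTheta
    · obtain ⟨C, hC, hCle⟩ := htail.exists_lintegral_one_sub_exp_le hν_mean
      refine isBigO_toReal_of_eventually_le
        (K := (2 + ∫⁻ v, ENNReal.ofReal (v : ℝ) ∂ν) * C) (by finiteness) hevtop ?_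
      filter_upwards [hCle] with n hn
      refine (hG.lintegral_numVertices_le n).trans ?_
      rw [mul_assoc]
      gcongr
    · obtain ⟨k, hk, hk0⟩ := ((htend.eventually_const_lt ENNReal.zero_lt_top).and
        (eventually_gt_atTop 0)).exists
      have ha : (0 : ℝ) < (k : ℝ)⁻¹ := by positivity
      obtain ⟨c, hc, hcle⟩ := hG.exists_mul_le_lintegral_numVertices ha hk.ne' htop
      refine isBigO_toReal_of_eventually_le (K := 2 * c⁻¹)
        (ENNReal.mul_ne_top (by simp) (ENNReal.inv_ne_top.2 hc.ne'))
        (.of_forall fun n => (hVfin n).ne) ?_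
      -- Since H(1/n) → ∞, it eventually exceeds 2 H(1/k); removing the weights above 1/k then costs
      -- at most half of it.
      have h2a : upperTail ν (k : ℝ)⁻¹ + upperTail ν (k : ℝ)⁻¹ < ∞ := by
        have := htop _ ha
        finiteness
      filter_upwards [htend.eventually_const_lt h2a, hevtop, eventually_gt_atTop 0] with n hn hnt hn0
      set B := ν {v | (n : ℝ)⁻¹ ≤ (v : ℝ) ∧ (v : ℝ) < (k : ℝ)⁻¹}
      have hsplit : upperTail ν (n : ℝ)⁻¹ ≤ B + upperTail ν (k : ℝ)⁻¹ := by
        refine (measure_mono fun v hv => ?_).trans (measure_union_le _ _)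
        rcases lt_or_ge (v : ℝ) (k : ℝ)⁻¹ with h | h
        · exact Or.inl ⟨hv, h⟩
        · exact Or.inr h
      have hB : upperTail ν (n : ℝ)⁻¹ ≤ 2 * B := by
        rw [← ENNReal.add_le_add_iff_right hnt]
        calc upperTail ν (n : ℝ)⁻¹ + upperTail ν (n : ℝ)⁻¹
            ≤ (B + upperTail ν (k : ℝ)⁻¹) + (B + upperTail ν (k : ℝ)⁻¹) := add_le_add hsplit hsplit
          _ = 2 * B + (upperTail ν (k : ℝ)⁻¹ + upperTail ν (k : ℝ)⁻¹) := by ring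
          _ ≤ 2 * B + upperTail ν (n : ℝ)⁻¹ := by gcongr
      have hBc : B ≤ c⁻¹ * ∫⁻ ω, numVertices T n ω ∂P := by
        rw [mul_comm, ← div_eq_mul_inv]
        refine (ENNReal.le_div_iff_mul_le (Or.inl hc.ne') (Or.inr (hVfin n).ne)).2 ?_
        rw [mul_comm]
        exact hcle n hn0
      calc upperTail ν (n : ℝ)⁻¹ ≤ 2 * B := hB
        _ ≤ 2 * (c⁻¹ * ∫⁻ ω, numVertices T n ω ∂P) := by gcongr
        _ = _ := (mul_assoc _ _ _).symm
  · constructor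
    · have := isBigO_toReal_of_eventually_le (F := atTop) (b := fun n : ℕ => (n : ℝ≥0∞))
        (by finiteness) (by simp) (.of_forall fun n => (hG.lintegral_numEdges_le n).trans_eq
          (mul_comm _ _))
      simpa using this
    · obtain ⟨c, hc, hcle⟩ := hG.exists_mul_le_lintegral_numEdges hν hν_mean
      have := isBigO_toReal_of_eventually_le (F := atTop) (a := fun n : ℕ => (n : ℝ≥0∞))
        (b := fun n : ℕ => ∫⁻ ω, numEdges T n ω ∂P) (K := c⁻¹)
        (ENNReal.inv_ne_top.2 hc.ne') (.of_forall fun n => (hEfin n).ne) (.of_forall fun n => ?_)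
      · simpa using this
      · rw [mul_comm, ← div_eq_mul_inv]
        exact (ENNReal.le_div_iff_mul_le (Or.inl hc.ne') (Or.inr (hEfin n).ne)).2 (hcle n)
  · obtain ⟨K, hK, hKle⟩ := htail.exists_pairIntegral_le hν_infinite hν_mean
    have hevtop' : ∀ᶠ n : ℕ in atTop, upperTail ν (√(n : ℝ))⁻¹ ≠ ∞ := by
      filter_upwards [eventually_gt_atTop 0] with n hn
      exact htop _ (by positivity)
    have h1 := isBigO_toReal_of_eventually_le hK
      (b := fun n : ℕ => upperTail ν (√(n : ℝ))⁻¹ *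
        min (ENNReal.ofReal √(n : ℝ)) (upperTail ν (n : ℝ)⁻¹))
      (by
        filter_upwards [hevtop'] with n hn
        exact ENNReal.mul_ne_top hn (ne_top_of_le_ne_top ENNReal.ofReal_ne_top (min_le_left _ _)))
      (hKle.mono fun n hn => (hBle n).trans hn)
    refine h1.trans ?_
    obtain ⟨D, hD, hDle⟩ := hH.isBigO.exists_pos
    have h2 : (fun n : ℕ => (min (ENNReal.ofReal √(n : ℝ)) (upperTail ν (n : ℝ)⁻¹)).toReal)
        =O[atTop] fun n : ℕ => min √(n : ℝ) ((n : ℝ) ^ α * l n) := by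
      -- The first entry of the minimum needs the constant 1, the second D; nonnegativity of ℓ lets
      -- the larger one serve both.
      refine IsBigO.of_bound (max D 1) ?_
      filter_upwards [hDle.bound, hevtop, eventually_gt_atTop 0] with n hn hnt hn0
      have hnn : 0 ≤ (n : ℝ) ^ α * l n :=
        mul_nonneg (by positivity) (htail.2.2.1.1 _ (by exact_mod_cast hn0))
      rw [Real.norm_of_nonneg ENNReal.toReal_nonneg, Real.norm_of_nonneg hnn] at hn
      rw [ENNReal.toReal_min ENNReal.ofReal_ne_top hnt, ENNReal.toReal_ofReal (Real.sqrt_nonneg _),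
        Real.norm_of_nonneg (le_min (Real.sqrt_nonneg _) ENNReal.toReal_nonneg),
        Real.norm_of_nonneg (le_min (Real.sqrt_nonneg _) hnn),
        mul_min_of_nonneg _ _ (by positivity)]
      refine min_le_min ?_ (hn.trans ?_)
      · exact le_mul_of_one_le_left (Real.sqrt_nonneg _) (le_max_right _ _)
      · exact mul_le_mul_of_nonneg_right (le_max_left _ _) hnn
    have h3 := hHs.isBigO.mul h2
    simp_rw [ENNReal.toReal_mul]
    refine h3.congr' .rfl ?_
    filter_upwards [eventually_gt_atTop 0] with n hn0
    have hn : (0 : ℝ) < n := by exact_mod_cast hn0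
    have e1 : √(n : ℝ) = (n : ℝ) ^ (1 / 2 : ℝ) := Real.sqrt_eq_rpow _
    have e2 : √(n : ℝ) ^ α = (n : ℝ) ^ (α / 2) := by
      rw [e1, ← Real.rpow_mul hn.le]
      ring_nf
    have e3 : (n : ℝ) ^ (α / 2) * √(n : ℝ) = (n : ℝ) ^ ((1 + α) / 2) := by
      rw [e1, ← Real.rpow_add hn]
      ring_nf
    have e4 : (n : ℝ) ^ (α / 2) * ((n : ℝ) ^ α * l n) = l n * (n : ℝ) ^ (3 * α / 2) := by
      rw [← mul_assoc, ← Real.rpow_add hn, mul_comm]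
      ring_nf
    rw [e2, mul_right_comm, mul_comm, mul_min_of_nonneg _ _ (by positivity), e3, e4]
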